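/- Let $n\ge 1$ and let $\overrightarrow{P}=(p_1,\dots,p_n)$ satisfy $1\le p_1\le p_2\le\dots\le p_n<\infty$. For Lebesgue measurable $f:\mathbb R^n\to\mathbb R$ put $$\|f\|_{\overrightarrow P}=\bigg(\int_{\mathbb R}\cdots\bigg(\int_{\mathbb R}\bigg(\int_{\mathbb R}|f(x_1,\dots,x_n)|^{p_1}\,dx_1\bigg)^{p_2/p_1}dx_2\bigg)^{p_3/p_2}\cdots\,dx_n\bigg)^{1/p_n}\in[0,\infty],$$ and let $L^{\overrightarrow P}(\mathbb R^n)$ be the space of all such $f$ with $\|f\|_{\overrightarrow P}<\infty$. Let $\chi:\mathbb R^n\to\mathbb R$ be a kernel, that is, $\chi\in L^1(\mathbb R^n)$, $\chi$ is bounded in a neighbourhood of the origin, $\sum_{\mathbf k\in\mathbb Z^n}\chi(\mathbf u-\mathbf k)=1$ for every $\mathbf u\in\mathbb R^n$ (with unconditional convergence), and for some real $\alpha\ge 0$ $$m_\alpha(\chi)=\sup_{\mathbf u\in\mathbb R^n}\sum_{\mathbf k\in\mathbb Z^n}|\chi(\mathbf u-\mathbf k)|\,\|\mathbf u-\mathbf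 k\|_2^{\alpha}<\infty ,$$ where $\|\cdot\|_2$ is the Euclidean norm and $0^0=1$. For $w>0$ and locally integrable $f$ let $$K_wf(\mathbf x)=\sum_{\mathbf k\in\mathbb Z^n}\chi(w\mathbf x-\mathbf k)\,w^n\int_{I_{\mathbf k,w}}f(\mathbf t)\,d\mathbf t,\qquad I_{\mathbf k,w}=\prod_{j=1}^n\Big[\frac{k_j}{w},\frac{k_j+1}{w}\Big].$$ Then every $f\in L^{\overrightarrow P}(\mathbb R^n)$ is locally integrable; for every $w>0$ the series defining $K_wf(\mathbf x)$ converges absolutely at every $\mathbf x\in\mathbb R^n$ and $K_wf\in L^{\overrightarrow P}(\mathbb R^n)$; and $$\lim_{w\to\infty}\|K_wf-f\|_{\overrightarrow P}=0 .$$ -/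

import Mathlib

open MeasureTheory Filter Topology
open scoped ENNReal

namespace MixedKantorovich

/-- The iterated mixed norm of a nonnegative function on `ℝⁿ` with exponents
`P = (p₁, …, pₙ)`: first the `L^{p₁}` norm in the first variable is taken, then the `L^{p₂}` norm
of the result in the second variable, and so on, the `L^{pₙ}` norm in the last variable
being outermost. -/
noncomputable def mixedLNorm : (n : ℕ) → (Fin n → ℝ) → ((Fin n → ℝ) → ℝ≥0∞) → ℝ≥0∞
  | 0, _, g => g Fin.elim0
  | n + 1, P, g =>
      mixedLNorm n (Fin.tail P)
        (fun y => (∫⁻ t : ℝ, g (Fin.cons t y) ^ P 0) ^ (1 / P 0))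

/-- The mixed norm `‖f‖_P`, with values in `[0, ∞]`, of a real function on `ℝⁿ`. -/
noncomputable def mixedNorm {n : ℕ} (P : Fin n → ℝ) (f : (Fin n → ℝ) → ℝ) : ℝ≥0∞ :=
  mixedLNorm n P (fun x => ‖f x‖ₑ)

/-- Membership in the mixed norm Lebesgue space `L^P(ℝⁿ)`: `f` is Lebesgue measurable
and `‖f‖_P < ∞`. -/
def MemMixedLp {n : ℕ} (P : Fin n → ℝ) (f : (Fin n → ℝ) → ℝ) : Prop :=
  AEStronglyMeasurable f volume ∧ mixedNorm P f < ∞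

/-- The difference `u - k` of a point `u` of `ℝⁿ` and an integer point `k`. -/
def subInt {n : ℕ} (u : Fin n → ℝ) (k : Fin n → ℤ) : Fin n → ℝ :=
  fun j => u j - (k j : ℝ)

/-- The absolute moment `m_α(χ) = sup_u ∑_k |χ(u - k)| ‖u - k‖₂ ^ α`, with values in `[0, ∞]`
(`‖·‖₂` is the Euclidean norm, and `0 ^ 0 = 1`). -/
noncomputable def absMoment {n : ℕ} (α : ℝ) (χ : (Fin n → ℝ) → ℝ) : ℝ≥0∞ :=
  ⨆ u : Fin n → ℝ, ∑' k : Fin n → ℤ,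
    ENNReal.ofReal (|χ (subInt u k)| * ‖WithLp.toLp 2 (subInt u k)‖ ^ α)

/-- `χ` is a kernel whose absolute moment of order `α` is finite. -/
structure IsKernel {n : ℕ} (α : ℝ) (χ : (Fin n → ℝ) → ℝ) : Prop where
  integrable : Integrable χ volume
  bounded_near_zero : ∃ C : ℝ, ∀ᶠ u in 𝓝 (0 : Fin n → ℝ), |χ u| ≤ C
  hasSum_one : ∀ u : Fin n → ℝ, HasSum (fun k : Fin n → ℤ => χ (subInt u k)) 1
  moment_lt_top : absMoment α χ < ∞

/-- The cube `I_{k,w} = ∏_j [k_j / w, (k_j + 1) / w]`. -/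
def cube {n : ℕ} (w : ℝ) (k : Fin n → ℤ) : Set (Fin n → ℝ) :=
  Set.Icc (fun j => (k j : ℝ) / w) (fun j => ((k j : ℝ) + 1) / w)

/-- The term with index `k` of the Kantorovich sampling series of `f` at `x`. -/
noncomputable def kantorovichTerm {n : ℕ} (χ : (Fin n → ℝ) → ℝ) (w : ℝ)
    (f : (Fin n → ℝ) → ℝ) (x : Fin n → ℝ) (k : Fin n → ℤ) : ℝ :=
  χ (subInt (w • x) k) * (w ^ n * ∫ t in cube w k, f t)

/-- The Kantorovich-type sampling operator
`(K_w f)(x) = ∑_k χ(w x - k) wⁿ ∫_{I_{k,w}} f(t) dt`. -/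
noncomputable def kantorovich {n : ℕ} (χ : (Fin n → ℝ) → ℝ) (w : ℝ)
    (f : (Fin n → ℝ) → ℝ) (x : Fin n → ℝ) : ℝ :=
  ∑' k : Fin n → ℤ, kantorovichTerm χ w f x k

end MixedKantorovich

/-!
The Kantorovich operators are dominated by a positive integral operator: with `T = latticeOp κ`,
`T h (x) = ∫ κ(x - ⌊t⌋) h(t) dt = ∑ₖ κ(x - k) ∫_{cell k} h` and `κ = |χ|`, the identity
`∑ₖ χ(u - k) = 1` gives, for every `x` and every constant `c`,
`|K_w f(x) - c| ≤ T (|f(·/w) - c|) (w x)` (`enorm_kantorovich_sub_le`). For almost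
every `x`, `κ` may be replaced here by a measurable representative.

The key estimate is `mixedLNorm_latticeOp_rpow_le`: if the periodization `T 1 = ∑ₖ κ(· - k)` is
bounded by `M` and the exponents increase and lie in `[1, p]`, then
`‖T h‖_P ≤ M ^ (1 - 1 / p) (∫ κ) ^ (1 / p) ‖h‖_P`. It is proved by induction on the dimension:
Jensen's inequality moves the power `p₁` inside `T`, and then, by Tonelli, integrating out `x₁`
turns `T` into the same kind of operator for the marginal kernel `∫ κ(x₁, ·) dx₁`, whose
periodization is again bounded by `M` and whose integral is the same. The next step needs
`p₂ / p₁ ≥ 1`, which is where the monotonicity of the exponents enters. Since mixed norms scale by a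
constant under dilations, the same bound holds at every scale `w`. Applied to indicators of balls it
also bounds integrals over balls by the mixed norm (`exists_setLIntegral_closedBall_le`), whence
local integrability and absolute convergence of the series.

For convergence, the bound reduces the problem to continuous `g` with compact support
(`exists_hasCompactSupport_mixedNorm_sub_le`). The part of `κ` in a large ball contributes at most
a multiple of the oscillation of `g` at scale `1 / w`, on a fixed ball. For the part `κ'` outside
the ball, the periodization need not be uniformly small (only `α ≥ 0` is assumed), but `∫ κ'` is
small, and this suffices because of the factor `(∫ κ') ^ (1 / p)`. The remaining term `|g(x)| ∑ₖ
κ'(w x - k)` is of the same form: the periodization of `κ'`, cut off to the unit cell, is itself a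
kernel with integral `∫ κ'` (`mixedLNorm_closedBall_mul_periodization_le`).
-/

namespace MixedKantorovich

/-! ### Splitting off the first coordinate -/

theorem measurable_cons {n : ℕ} :
    Measurable (fun q : (Fin n → ℝ) × ℝ => (Fin.cons q.2 q.1 : Fin (n + 1) → ℝ)) := by
  refine measurable_pi_iff.2 fun i => ?_
  refine Fin.cases ?_ (fun j => ?_) i
  · simpa using measurable_snd
  · simpa [Function.comp_def] using (measurable_pi_apply j).comp (measurable_fst (β := ℝ))

theorem measurePreserving_cons {n : ℕ} :
    MeasurePreserving (fun q : (Fin n → ℝ) × ℝ => (Fin.cons q.2 q.1 : Fin (n + 1) → ℝ))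
      ((volume : Measure (Fin n → ℝ)).prod (volume : Measure ℝ)) volume := by
  have h := (volume_preserving_piFinSuccAbove (fun _ : Fin (n + 1) => ℝ) 0).symm
  have h2 := h.comp (Measure.measurePreserving_swap (μ := (volume : Measure (Fin n → ℝ)))
    (ν := (volume : Measure ℝ)))
  have e : (fun q : (Fin n → ℝ) × ℝ => (Fin.cons q.2 q.1 : Fin (n + 1) → ℝ)) =
      (MeasurableEquiv.piFinSuccAbove (fun _ : Fin (n + 1) => ℝ) 0).symm ∘ Prod.swap :=
    funext fun q => (Fin.insertNth_zero' q.2 q.1).symm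
  rw [e]
  exact h2

theorem lintegral_cons {n : ℕ} {h : (Fin (n + 1) → ℝ) → ℝ≥0∞} (hh : Measurable h) :
    ∫⁻ x, h x = ∫⁻ y : Fin n → ℝ, ∫⁻ t : ℝ, h (Fin.cons t y) := by
  rw [← measurePreserving_cons.lintegral_comp hh,
    lintegral_prod (fun q : (Fin n → ℝ) × ℝ => h (Fin.cons q.2 q.1))
      (hh.comp measurable_cons).aemeasurable]

theorem ae_ae_cons {n : ℕ} {p : (Fin (n + 1) → ℝ) → Prop} (h : ∀ᵐ x, p x) :
    ∀ᵐ y : Fin n → ℝ, ∀ᵐ t : ℝ, p (Fin.cons t y) :=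
  Measure.ae_ae_of_ae_prod (measurePreserving_cons.quasiMeasurePreserving.ae h)

theorem ae_of_ae_ae_cons {n : ℕ} {p : (Fin (n + 1) → ℝ) → Prop} (hp : MeasurableSet {x | p x})
    (h : ∀ᵐ y : Fin n → ℝ, ∀ᵐ t : ℝ, p (Fin.cons t y)) : ∀ᵐ x, p x := by
  have h2 := (Measure.ae_prod_iff_ae_ae (μ := (volume : Measure (Fin n → ℝ)))
    (ν := (volume : Measure ℝ)) (measurable_cons hp)).2 h
  rw [← measurePreserving_cons.map_eq]
  exact (ae_map_iff measurePreserving_cons.measurable.aemeasurable hp).2 h2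

theorem measurable_cons_left {n : ℕ} {h : (Fin (n + 1) → ℝ) → ℝ≥0∞} (hh : Measurable h)
    (y : Fin n → ℝ) : Measurable fun t : ℝ => h (Fin.cons t y) :=
  (hh.comp measurable_cons).comp measurable_prodMk_left

theorem measurable_lintegral_cons {n : ℕ} {h : (Fin (n + 1) → ℝ) → ℝ≥0∞} (hh : Measurable h) :
    Measurable fun y : Fin n → ℝ => ∫⁻ t : ℝ, h (Fin.cons t y) :=
  (hh.comp measurable_cons).lintegral_prod_right'

/-! ### The iterated mixed norm -/

theorem mixedLNorm_mono_ae {n : ℕ} {P : Fin n → ℝ} (hP : ∀ i, 0 < P i)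
    {g h : (Fin n → ℝ) → ℝ≥0∞} (hgh : g ≤ᵐ[volume] h) : mixedLNorm n P g ≤ mixedLNorm n P h := by
  induction n with
  | zero =>
    -- On the one-point space `Fin 0 → ℝ` an almost everywhere inequality holds everywhere.
    obtain ⟨x, hx⟩ := hgh.exists
    rw [Subsingleton.elim x Fin.elim0] at hx
    exact hx
  | succ n ih =>
    refine ih (fun i => hP _) ?_
    filter_upwards [ae_ae_cons hgh] with y hy
    have := hP 0
    refine ENNReal.rpow_le_rpow (lintegral_mono_ae ?_) (by positivity)
    filter_upwards [hy] with t ht using ENNReal.rpow_le_rpow ht this.le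

theorem mixedLNorm_mono {n : ℕ} {P : Fin n → ℝ} (hP : ∀ i, 0 < P i)
    {g h : (Fin n → ℝ) → ℝ≥0∞} (hgh : ∀ x, g x ≤ h x) : mixedLNorm n P g ≤ mixedLNorm n P h :=
  mixedLNorm_mono_ae hP (Eventually.of_forall hgh)

theorem mixedLNorm_congr_ae {n : ℕ} {P : Fin n → ℝ} (hP : ∀ i, 0 < P i)
    {g h : (Fin n → ℝ) → ℝ≥0∞} (hgh : g =ᵐ[volume] h) : mixedLNorm n P g = mixedLNorm n P h :=
  le_antisymm (mixedLNorm_mono_ae hP hgh.le) (mixedLNorm_mono_ae hP hgh.symm.le)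

theorem mixedLNorm_const_mul {n : ℕ} {P : Fin n → ℝ} (hP : ∀ i, 0 < P i) {c : ℝ≥0∞} (hc : c ≠ ∞)
    (h : (Fin n → ℝ) → ℝ≥0∞) : mixedLNorm n P (fun x => c * h x) = c * mixedLNorm n P h := by
  induction n with
  | zero => rfl
  | succ n ih =>
    have h0 := hP 0
    rw [mixedLNorm, mixedLNorm, ← ih (P := Fin.tail P) (fun i => hP _)]
    congr 1
    ext y
    simp_rw [ENNReal.mul_rpow_of_nonneg _ _ h0.le]
    rw [lintegral_const_mul' _ _ (ENNReal.rpow_ne_top_of_nonneg h0.le hc),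
      ENNReal.mul_rpow_of_nonneg _ _ (by positivity), ← ENNReal.rpow_mul, mul_one_div_cancel h0.ne',
      ENNReal.rpow_one]

theorem measurable_lintegral_rpow_cons {n : ℕ} {h : (Fin (n + 1) → ℝ) → ℝ≥0∞}
    (hh : Measurable h) (p : ℝ) :
    Measurable fun y : Fin n → ℝ => (∫⁻ t : ℝ, h (Fin.cons t y) ^ p) ^ (1 / p) :=
  (measurable_lintegral_cons (hh.pow_const p)).pow_const _

theorem mixedLNorm_add_le {n : ℕ} {P : Fin n → ℝ} (hP : ∀ i, 1 ≤ P i)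
    {g h : (Fin n → ℝ) → ℝ≥0∞} (hg : Measurable g) (hh : Measurable h) :
    mixedLNorm n P (fun x => g x + h x) ≤ mixedLNorm n P g + mixedLNorm n P h := by
  induction n with
  | zero => exact le_rfl
  | succ n ih =>
    refine (mixedLNorm_mono (P := Fin.tail P) (fun i => one_pos.trans_le (hP _)) fun y => ?_).trans
      (ih (P := Fin.tail P) (fun i => hP _) (measurable_lintegral_rpow_cons hg _)
        (measurable_lintegral_rpow_cons hh _))
    exact ENNReal.lintegral_Lp_add_le (measurable_cons_left hg y).aemeasurable
      (measurable_cons_left hh y).aemeasurable (hP 0)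

theorem lintegral_comp_mul_left_of_pos {w : ℝ} (hw : 0 < w) (φ : ℝ → ℝ≥0∞) :
    ∫⁻ t, φ (w * t) = ENNReal.ofReal w⁻¹ * ∫⁻ t, φ t := by
  have h := lintegral_map_equiv (μ := volume) φ (Homeomorph.mulLeft₀ w hw.ne').toMeasurableEquiv
  simp only [Homeomorph.toMeasurableEquiv_coe, Homeomorph.coe_mulLeft₀] at h
  rw [← h, Real.map_volume_mul_left hw.ne', lintegral_smul_measure, abs_of_pos (inv_pos.2 hw),
    smul_eq_mul]

theorem smul_cons {n : ℕ} (w t : ℝ) (y : Fin n → ℝ) :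
    w • (Fin.cons t y : Fin (n + 1) → ℝ) = Fin.cons (w * t) (w • y) := by
  ext i
  refine Fin.cases ?_ (fun j => ?_) i <;> simp

/-- Dilations multiply the mixed norm by a constant which does not depend on the function. -/
theorem exists_mixedLNorm_comp_smul {n : ℕ} {P : Fin n → ℝ} (hP : ∀ i, 0 < P i) {w : ℝ}
    (hw : 0 < w) : ∃ c : ℝ≥0∞, c ≠ 0 ∧ c ≠ ∞ ∧ ∀ h : (Fin n → ℝ) → ℝ≥0∞,
      mixedLNorm n P (fun x => h (w • x)) = c * mixedLNorm n P h := by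
  induction n with
  | zero =>
    refine ⟨1, one_ne_zero, ENNReal.one_ne_top, fun h => ?_⟩
    rw [one_mul]
    exact congrArg h (Subsingleton.elim _ _)
  | succ n ih =>
    obtain ⟨c, hc0, hc, H⟩ := ih (P := Fin.tail P) (fun i => hP _)
    have h0 := hP 0
    have hw' : ENNReal.ofReal w⁻¹ ≠ 0 := by simpa using hw
    have hd : ENNReal.ofReal w⁻¹ ^ (1 / P 0) ≠ ∞ :=
      ENNReal.rpow_ne_top_of_nonneg (by positivity) ENNReal.ofReal_ne_top
    refine ⟨ENNReal.ofReal w⁻¹ ^ (1 / P 0) * c, mul_ne_zero ?_ hc0, ENNReal.mul_ne_top hd hc,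
      fun h => ?_⟩
    · exact (ENNReal.rpow_pos (pos_iff_ne_zero.2 hw') ENNReal.ofReal_ne_top).ne'
    · rw [mixedLNorm, mixedLNorm, mul_assoc, ← H, 
        ← mixedLNorm_const_mul (P := Fin.tail P) (fun i => hP _) hd]
      congr 1
      ext y
      simp_rw [smul_cons]
      rw [lintegral_comp_mul_left_of_pos hw fun t => h (Fin.cons t (w • y)) ^ P 0,
        ENNReal.mul_rpow_of_nonneg _ _ (by positivity)]

theorem ae_lt_top_of_mixedLNorm_lt_top {n : ℕ} {P : Fin n → ℝ} (hP : ∀ i, 0 < P i)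
    {h : (Fin n → ℝ) → ℝ≥0∞} (hh : Measurable h) (hfin : mixedLNorm n P h < ∞) :
    ∀ᵐ x, h x < ∞ := by
  induction n with
  | zero =>
    refine Eventually.of_forall fun x => ?_
    rw [Subsingleton.elim x Fin.elim0]
    exact hfin
  | succ n ih =>
    have h0 := hP 0
    refine ae_of_ae_ae_cons (measurableSet_lt hh measurable_const) ?_
    filter_upwards [ih (fun i => hP _) (measurable_lintegral_rpow_cons hh _) hfin] with y hy
    have hy' : ∫⁻ t : ℝ, h (Fin.cons t y) ^ P 0 ≠ ∞ := fun hc => by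
      rw [hc, ENNReal.top_rpow_of_pos (by positivity)] at hy
      exact lt_irrefl _ hy
    filter_upwards [ae_lt_top ((measurable_cons_left hh y).pow_const _) hy'] with t ht
    exact (ENNReal.rpow_lt_top_iff_of_pos h0).1 ht

/-- Dominated convergence for the mixed norm. -/
theorem tendsto_mixedLNorm_zero_of_dominated {n : ℕ} {P : Fin n → ℝ} (hP : ∀ i, 0 < P i)
    {F : ℕ → (Fin n → ℝ) → ℝ≥0∞} {G : (Fin n → ℝ) → ℝ≥0∞} (hF : ∀ j, Measurable (F j))
    (hG : Measurable G) (hFG : ∀ j, F j ≤ᵐ[volume] G) (hfin : mixedLNorm n P G < ∞)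
    (hlim : ∀ᵐ x, Tendsto (fun j => F j x) atTop (𝓝 0)) :
    Tendsto (fun j => mixedLNorm n P (F j)) atTop (𝓝 0) := by
  induction n with
  | zero =>
    obtain ⟨x, hx⟩ := hlim.exists
    rw [Subsingleton.elim x Fin.elim0] at hx
    exact hx
  | succ n ih =>
    have h0 := hP 0
    have hq : 0 < 1 / P 0 := by positivity
    refine ih (P := Fin.tail P) (fun i => hP _)
      (F := fun j y => (∫⁻ t : ℝ, F j (Fin.cons t y) ^ P 0) ^ (1 / P 0))
      (G := fun y => (∫⁻ t : ℝ, G (Fin.cons t y) ^ P 0) ^ (1 / P 0))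
      (fun j => measurable_lintegral_rpow_cons (hF j) _) (measurable_lintegral_rpow_cons hG _)
      (fun j => ?_) hfin ?_
    · filter_upwards [ae_ae_cons (hFG j)] with y hy
      refine ENNReal.rpow_le_rpow (lintegral_mono_ae ?_) hq.le
      filter_upwards [hy] with t ht using ENNReal.rpow_le_rpow ht h0.le
    · filter_upwards [ae_ae_cons hlim, ae_ae_cons (ae_all_iff.2 hFG),
        ae_lt_top_of_mixedLNorm_lt_top (P := Fin.tail P) (fun i => hP _)
          (measurable_lintegral_rpow_cons hG _) hfin] with y hy1 hy2 hy3
      have hy' : ∫⁻ t : ℝ, G (Fin.cons t y) ^ P 0 ≠ ∞ := fun hc => by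
        rw [hc, ENNReal.top_rpow_of_pos hq] at hy3
        exact lt_irrefl _ hy3
      have key := tendsto_lintegral_of_dominated_convergence (μ := volume)
        (F := fun j t => F j (Fin.cons t y) ^ P 0) (f := fun _ => 0)
        (fun t => G (Fin.cons t y) ^ P 0)
        (fun j => (measurable_cons_left (hF j) y).pow_const _)
        (fun j => by filter_upwards [hy2] with t ht using ENNReal.rpow_le_rpow (ht j) h0.le) hy'
        (by
          filter_upwards [hy1] with t ht
          simpa [Function.comp_def, ENNReal.zero_rpow_of_pos h0] using
            (ENNReal.continuous_rpow_const (y := P 0)).continuousAt.tendsto.comp ht)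
      simpa [Function.comp_def, ENNReal.zero_rpow_of_pos h0,
        ENNReal.zero_rpow_of_pos (inv_pos.2 h0)] using
        (ENNReal.continuous_rpow_const (y := 1 / P 0)).continuousAt.tendsto.comp key

theorem mixedLNorm_indicator_pi {n : ℕ} {P : Fin n → ℝ} (hP : ∀ i, 0 < P i)
    {I : Fin n → Set ℝ} (hI : ∀ i, MeasurableSet (I i)) (hfin : ∀ i, volume (I i) ≠ ∞) :
    mixedLNorm n P ((Set.univ.pi I).indicator 1) = ∏ i, volume (I i) ^ (1 / P i) := by
  induction n with
  | zero =>
    simp [mixedLNorm, Set.indicator]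
  | succ n ih =>
    have h0 := hP 0
    have hq : 0 < 1 / P 0 := by positivity
    rw [mixedLNorm, Fin.prod_univ_succ]
    have key := ih (P := Fin.tail P) (I := Fin.tail I) (fun i => hP _) (fun i => hI _)
      (fun i => hfin _)
    change _ = volume (I 0) ^ (1 / P 0) * ∏ i, volume (Fin.tail I i) ^ (1 / Fin.tail P i)
    rw [← key, ← mixedLNorm_const_mul (P := Fin.tail P) (fun i => hP _)
      (ENNReal.rpow_ne_top_of_nonneg hq.le (hfin 0))]
    congr 1
    ext y
    by_cases hy : y ∈ Set.univ.pi (Fin.tail I)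
    · have : ∀ t : ℝ, (Set.univ.pi I).indicator (1 : (Fin (n + 1) → ℝ) → ℝ≥0∞) (Fin.cons t y) ^ P 0
          = (I 0).indicator 1 t := fun t => by
        have hmem : (Fin.cons t y : Fin (n + 1) → ℝ) ∈ Set.univ.pi I ↔ t ∈ I 0 := by
          simp only [Set.mem_univ_pi] at hy ⊢
          rw [Fin.forall_fin_succ]
          exact and_iff_left hy
        by_cases ht : t ∈ I 0
        · simp [hmem, ht]
        · simp [hmem, ht, ENNReal.zero_rpow_of_pos h0]
      simp_rw [this]
      rw [lintegral_indicator_one (hI 0)]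
      simp [hy]
    · have : ∀ t : ℝ, (Set.univ.pi I).indicator (1 : (Fin (n + 1) → ℝ) → ℝ≥0∞) (Fin.cons t y) ^ P 0
          = 0 := fun t => by
        have hmem : (Fin.cons t y : Fin (n + 1) → ℝ) ∉ Set.univ.pi I := fun hc => hy <| by
          simp only [Set.mem_univ_pi] at hc ⊢
          intro i
          simpa [Fin.tail] using hc i.succ
        simp [hmem, ENNReal.zero_rpow_of_pos h0]
      simp_rw [this]
      simp [hy, h0]

/-! ### Unit cells of the integer lattice -/

/-- The coordinatewise integer part `⌊t⌋ ∈ ℤⁿ` of a point of `ℝⁿ`. -/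
noncomputable def intPart {n : ℕ} (t : Fin n → ℝ) : Fin n → ℤ := fun j => ⌊t j⌋

/-- The half-open unit cell `∏ⱼ [kⱼ, kⱼ + 1)`. -/
def cell {n : ℕ} (k : Fin n → ℤ) : Set (Fin n → ℝ) :=
  Set.univ.pi fun j => Set.Ico (k j : ℝ) ((k j : ℝ) + 1)

theorem intPart_eq_iff {n : ℕ} {t : Fin n → ℝ} {k : Fin n → ℤ} : intPart t = k ↔ t ∈ cell k := by
  simp [intPart, cell, funext_iff, Int.floor_eq_iff]

theorem measurableSet_cell {n : ℕ} (k : Fin n → ℤ) : MeasurableSet (cell k) :=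
  MeasurableSet.univ_pi fun _ => measurableSet_Ico

theorem volume_cell {n : ℕ} (k : Fin n → ℤ) : volume (cell k) = 1 := by
  simp [cell, volume_pi_pi]

theorem measurable_intPart {n : ℕ} : Measurable (intPart : (Fin n → ℝ) → Fin n → ℤ) :=
  measurable_pi_iff.2 fun j => Int.measurable_floor.comp (measurable_pi_apply j)

theorem measurable_subInt_intPart {n : ℕ} :
    Measurable fun q : (Fin n → ℝ) × (Fin n → ℝ) => subInt q.1 (intPart q.2) := by
  refine measurable_pi_iff.2 fun j => ?_
  exact ((measurable_pi_apply j).comp measurable_fst).sub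
    (measurable_from_top.comp (Int.measurable_floor.comp ((measurable_pi_apply j).comp
      measurable_snd)))

theorem cube_ae_eq_cell {n : ℕ} (k : Fin n → ℤ) :
    (cube 1 k : Set (Fin n → ℝ)) =ᵐ[volume] cell k := by
  simp only [cube, div_one]
  exact Measure.univ_pi_Ico_ae_eq_Icc.symm

theorem lintegral_intPart_mul {n : ℕ} (ψ : (Fin n → ℤ) → ℝ≥0∞) {h : (Fin n → ℝ) → ℝ≥0∞}
    (hh : Measurable h) :
    ∫⁻ t, ψ (intPart t) * h t = ∑' k, ψ k * ∫⁻ t in cell k, h t := by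
  have hψ : Measurable ψ := Measurable.of_discrete
  have h1 : ∫⁻ t, ψ (intPart t) * h t = ∫⁻ k, ψ k ∂((volume.withDensity h).map intPart) := by
    rw [lintegral_map hψ measurable_intPart,
      lintegral_withDensity_eq_lintegral_mul (g := fun t => ψ (intPart t)) _ hh
        (hψ.comp measurable_intPart)]
    simp [mul_comm]
  rw [h1, lintegral_countable']
  congr 1
  ext k
  have h2 : intPart ⁻¹' {k} = cell k := by
    ext t
    simp [intPart_eq_iff]
  rw [Measure.map_apply measurable_intPart (measurableSet_singleton k), h2,
    withDensity_apply _ (measurableSet_cell k)]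

/-! ### The sampling operator of a nonnegative kernel -/

/-- The integral operator `h ↦ ∫ κ(· - ⌊t⌋) h(t) dt = ∑ₖ κ(· - k) ∫_{cell k} h` of a
nonnegative kernel `κ`. -/
noncomputable def latticeOp {n : ℕ} (κ h : (Fin n → ℝ) → ℝ≥0∞) (x : Fin n → ℝ) : ℝ≥0∞ :=
  ∫⁻ t, κ (subInt x (intPart t)) * h t

theorem latticeOp_eq_tsum {n : ℕ} (κ : (Fin n → ℝ) → ℝ≥0∞) {h : (Fin n → ℝ) → ℝ≥0∞}
    (hh : Measurable h) (x : Fin n → ℝ) :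
    latticeOp κ h x = ∑' k, κ (subInt x k) * ∫⁻ t in cell k, h t :=
  lintegral_intPart_mul (fun k => κ (subInt x k)) hh

theorem latticeOp_one {n : ℕ} (κ : (Fin n → ℝ) → ℝ≥0∞) (x : Fin n → ℝ) :
    latticeOp κ 1 x = ∑' k, κ (subInt x k) := by
  rw [latticeOp_eq_tsum κ measurable_one]
  simp [volume_cell]

theorem measurable_kernel {n : ℕ} {κ : (Fin n → ℝ) → ℝ≥0∞} (hκ : Measurable κ)
    (x : Fin n → ℝ) : Measurable fun t => κ (subInt x (intPart t)) :=
  (hκ.comp measurable_subInt_intPart).comp measurable_prodMk_left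

theorem measurable_latticeOp {n : ℕ} {κ h : (Fin n → ℝ) → ℝ≥0∞} (hκ : Measurable κ)
    (hh : Measurable h) : Measurable (latticeOp κ h) :=
  ((hκ.comp measurable_subInt_intPart).mul (hh.comp measurable_snd)).lintegral_prod_right'

theorem latticeOp_mono {n : ℕ} {κ κ' g h : (Fin n → ℝ) → ℝ≥0∞} (hκ : ∀ x, κ x ≤ κ' x)
    (hgh : ∀ x, g x ≤ h x) (x : Fin n → ℝ) : latticeOp κ g x ≤ latticeOp κ' h x :=
  lintegral_mono fun t => mul_le_mul' (hκ _) (hgh t)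

theorem latticeOp_add {n : ℕ} {κ g h : (Fin n → ℝ) → ℝ≥0∞} (hκ : Measurable κ)
    (hg : Measurable g) (x : Fin n → ℝ) :
    latticeOp κ (fun t => g t + h t) x = latticeOp κ g x + latticeOp κ h x := by
  simp only [latticeOp, mul_add]
  exact lintegral_add_left ((measurable_kernel hκ x).mul hg) _

theorem latticeOp_const {n : ℕ} {κ : (Fin n → ℝ) → ℝ≥0∞} (hκ : Measurable κ) (c : ℝ≥0∞)
    (x : Fin n → ℝ) : latticeOp κ (fun _ => c) x = latticeOp κ 1 x * c := by
  simp only [latticeOp, Pi.one_apply, mul_one]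
  exact lintegral_mul_const _ (measurable_kernel hκ x)

/-- Integrating the periodization of `φ` over a fundamental domain `Q` gives back the integral
of `φ`; the periodization is written as an integral over the translates by the values of `e`. -/
theorem setLIntegral_lintegral_sub {G : Type*} [AddGroup G] [MeasurableSpace G] [MeasurableAdd₂ G]
    [MeasurableNeg G] (μ : Measure G) [SFinite μ] [μ.IsAddRightInvariant] {e : G → G}
    (he : Measurable e) {Q : Set G} (hQ : MeasurableSet Q) (hvol : ∀ v, μ {s | v + e s ∈ Q} = 1)
    {φ : G → ℝ≥0∞} (hφ : Measurable φ) :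
    ∫⁻ t in Q, ∫⁻ s, φ (t - e s) ∂μ ∂μ = ∫⁻ v, φ v ∂μ := by
  have hi : Measurable (Q.indicator (1 : G → ℝ≥0∞)) := measurable_one.indicator hQ
  have hm1 : Measurable fun q : G × G => φ (q.1 - e q.2) := by
    simp only [sub_eq_add_neg]
    exact hφ.comp (measurable_fst.add (he.comp measurable_snd).neg)
  calc ∫⁻ t in Q, ∫⁻ s, φ (t - e s) ∂μ ∂μ
      = ∫⁻ t, ∫⁻ s, Q.indicator 1 t * φ (t - e s) ∂μ ∂μ := by
        rw [← lintegral_indicator hQ]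
        refine lintegral_congr fun t => ?_
        by_cases ht : t ∈ Q <;> simp [ht]
    _ = ∫⁻ s, ∫⁻ t, Q.indicator 1 t * φ (t - e s) ∂μ ∂μ :=
        lintegral_lintegral_swap ((hi.comp measurable_fst).mul hm1).aemeasurable
    _ = ∫⁻ s, ∫⁻ v, Q.indicator 1 (v + e s) * φ v ∂μ ∂μ := by
        refine lintegral_congr fun s => ?_
        rw [← lintegral_add_right_eq_self _ (e s)]
        simp
    _ = ∫⁻ v, ∫⁻ s, Q.indicator 1 (v + e s) * φ v ∂μ ∂μ :=
        lintegral_lintegral_swap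
          ((hi.comp (measurable_snd.add (he.comp measurable_fst))).mul
            (hφ.comp measurable_snd)).aemeasurable
    _ = ∫⁻ v, φ v ∂μ := by
        refine lintegral_congr fun v => ?_
        have hmeas : Measurable fun s => v + e s := measurable_const.add he
        rw [lintegral_mul_const (f := fun s => Q.indicator 1 (v + e s)) _ (hi.comp hmeas)]
        have : ∫⁻ s, Q.indicator (1 : G → ℝ≥0∞) (v + e s) ∂μ = μ {s | v + e s ∈ Q} := by
          exact lintegral_indicator_one (hmeas hQ)
        rw [this, hvol, one_mul]

theorem setLIntegral_lintegral_sub_floor {φ : ℝ → ℝ≥0∞} (hφ : Measurable φ) :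
    ∫⁻ t in Set.Ico (0 : ℝ) 1, ∫⁻ s : ℝ, φ (t - (⌊s⌋ : ℝ)) = ∫⁻ v, φ v := by
  refine setLIntegral_lintegral_sub volume (measurable_from_top.comp Int.measurable_floor)
    measurableSet_Ico (fun v => ?_) hφ
  have : {s : ℝ | v + (⌊s⌋ : ℝ) ∈ Set.Ico (0 : ℝ) 1} =
      Set.Ico ((-⌊v⌋ : ℤ) : ℝ) ((-⌊v⌋ : ℤ) + 1) := by
    ext s
    rw [Set.mem_ofPred_eq, ← Int.floor_eq_zero_iff, Int.floor_add_intCast, Set.mem_Ico,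
      ← Int.floor_eq_iff]
    omega
  simp only [Function.comp_apply]
  rw [this]
  simp

theorem setLIntegral_cell_latticeOp_one {n : ℕ} {κ : (Fin n → ℝ) → ℝ≥0∞} (hκ : Measurable κ) :
    ∫⁻ x in cell 0, latticeOp κ 1 x = ∫⁻ x, κ x := by
  have he : Measurable fun s : Fin n → ℝ => fun j => ((intPart s j : ℤ) : ℝ) :=
    measurable_pi_iff.2 fun j => measurable_from_top.comp
      (Int.measurable_floor.comp (measurable_pi_apply j))
  rw [← setLIntegral_lintegral_sub volume he (measurableSet_cell 0) (fun v => ?_) hκ]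
  · simp only [latticeOp, Pi.one_apply, mul_one]
    rfl
  · have : {s : Fin n → ℝ | (v + fun j => ((intPart s j : ℤ) : ℝ)) ∈ cell 0} =
        cell (-intPart v) := by
      ext s
      rw [Set.mem_ofPred_eq, ← intPart_eq_iff, ← intPart_eq_iff, funext_iff, funext_iff]
      refine forall_congr' fun j => ?_
      simp only [intPart, Pi.add_apply, Int.floor_add_intCast, Pi.zero_apply, Pi.neg_apply]
      omega
    rw [this, volume_cell]

/-! ### Boundedness of the sampling operator in the mixed norm -/

/-- Jensen's inequality for the weight `κ(x - ⌊·⌋)`, whose total mass is at most `M`. -/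
theorem latticeOp_rpow_le {n : ℕ} {κ h : (Fin n → ℝ) → ℝ≥0∞} (hκ : Measurable κ)
    (hh : Measurable h) {s q : ℝ} (hs : 0 < s) (hsq : s ≤ q) {M : ℝ≥0∞} {x : Fin n → ℝ}
    (hx : latticeOp κ 1 x ≤ M) :
    latticeOp κ (fun t => h t ^ s) x ^ (1 / s) ≤
      latticeOp κ (fun t => h t ^ q) x ^ (1 / q) * M ^ (1 / s - 1 / q) := by
  have hexp : 0 ≤ 1 / s - 1 / q := sub_nonneg.2 (one_div_le_one_div_of_le hs hsq)
  have hk := measurable_kernel hκ x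
  have key := eLpNorm'_le_eLpNorm'_mul_rpow_measure_univ
    (μ := volume.withDensity fun t => κ (subInt x (intPart t))) hs hsq
    hh.aestronglyMeasurable
  have e : ∀ r : ℝ, eLpNorm' h r (volume.withDensity fun t => κ (subInt x (intPart t))) =
      latticeOp κ (fun t => h t ^ r) x ^ (1 / r) := fun r => by
    simp only [eLpNorm', enorm_eq_self]
    rw [lintegral_withDensity_eq_lintegral_mul _ hk (hh.pow_const r)]
    rfl
  rw [e, e] at key
  refine key.trans (mul_le_mul_right (ENNReal.rpow_le_rpow ?_ hexp) _)
  rw [withDensity_apply _ MeasurableSet.univ, Measure.restrict_univ]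
  simpa [latticeOp] using hx

theorem subInt_cons {n : ℕ} (t : ℝ) (y : Fin n → ℝ) (u : Fin (n + 1) → ℝ) :
    subInt (Fin.cons t y) (intPart u) =
      Fin.cons (t - (⌊u 0⌋ : ℝ)) (subInt y (intPart (Fin.tail u))) := by
  ext i
  refine Fin.cases ?_ (fun j => ?_) i <;> simp [subInt, intPart, Fin.tail]

/-- Integrating out the first variable turns the sampling operator in dimension `n + 1` into the
sampling operator in dimension `n` with the marginal kernel. -/
theorem lintegral_latticeOp_cons {n : ℕ} {κ g : (Fin (n + 1) → ℝ) → ℝ≥0∞} (hκ : Measurable κ)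
    (hg : Measurable g) (y : Fin n → ℝ) :
    ∫⁻ t : ℝ, latticeOp κ g (Fin.cons t y) =
      latticeOp (fun z => ∫⁻ t : ℝ, κ (Fin.cons t z)) (fun z => ∫⁻ s : ℝ, g (Fin.cons s z)) y := by
  have hm : Measurable fun q : ℝ × (Fin (n + 1) → ℝ) =>
      κ (subInt (Fin.cons q.1 y) (intPart q.2)) :=
    (hκ.comp measurable_subInt_intPart).comp
      ((measurable_cons.comp (measurable_const.prodMk measurable_fst)).prodMk measurable_snd)
  have htail : Measurable fun u : Fin (n + 1) → ℝ => Fin.tail u :=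
    measurable_pi_iff.2 fun j => measurable_pi_apply j.succ
  have hκ' := measurable_lintegral_cons hκ
  calc ∫⁻ t : ℝ, latticeOp κ g (Fin.cons t y)
      = ∫⁻ u, ∫⁻ t : ℝ, κ (subInt (Fin.cons t y) (intPart u)) * g u :=
        lintegral_lintegral_swap (hm.mul (hg.comp measurable_snd)).aemeasurable
    _ = ∫⁻ u, (∫⁻ t : ℝ, κ (Fin.cons t (subInt y (intPart (Fin.tail u))))) * g u := by
        refine lintegral_congr fun u => ?_
        rw [lintegral_mul_const (f := fun t : ℝ => κ (subInt (Fin.cons t y) (intPart u))) _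
          (hm.comp measurable_prodMk_right)]
        simp_rw [subInt_cons]
        rw [lintegral_sub_right_eq_self
          (fun t : ℝ => κ (Fin.cons t (subInt y (intPart (Fin.tail u)))))]
    _ = _ := by
        have hm2 : Measurable fun u =>
            (∫⁻ t : ℝ, κ (Fin.cons t (subInt y (intPart (Fin.tail u))))) * g u :=
          ((measurable_kernel hκ' y).comp htail).mul hg
        rw [lintegral_cons hm2]
        simp_rw [Fin.tail_cons]
        refine lintegral_congr fun z => ?_
        exact lintegral_const_mul _ (measurable_cons_left hg z)

/-- The periodization of the marginal kernel is the average of that of `κ` over a period in the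
first variable, so that it inherits every upper bound. -/
theorem latticeOp_marginal_one {n : ℕ} {κ : (Fin (n + 1) → ℝ) → ℝ≥0∞} (hκ : Measurable κ)
    (y : Fin n → ℝ) :
    latticeOp (fun z => ∫⁻ t : ℝ, κ (Fin.cons t z)) 1 y =
      ∫⁻ t in Set.Ico (0 : ℝ) 1, latticeOp κ 1 (Fin.cons t y) := by
  have hm : Measurable fun q : (Fin n → ℝ) × ℝ × ℝ =>
      κ (Fin.cons (q.2.1 - (⌊q.2.2⌋ : ℝ)) (subInt y (intPart q.1))) := by
    refine hκ.comp (measurable_cons.comp (Measurable.prodMk ?_ ?_))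
    · exact measurable_subInt_intPart.comp (measurable_const.prodMk measurable_fst)
    · exact measurable_snd.fst.sub
        (measurable_from_top.comp (Int.measurable_floor.comp measurable_snd.snd))
  calc latticeOp (fun z => ∫⁻ t : ℝ, κ (Fin.cons t z)) 1 y
      = ∫⁻ z, ∫⁻ t in Set.Ico (0 : ℝ) 1, ∫⁻ s : ℝ,
          κ (Fin.cons (t - (⌊s⌋ : ℝ)) (subInt y (intPart z))) := by
        simp only [latticeOp, Pi.one_apply, mul_one]
        exact lintegral_congr fun z =>
          (setLIntegral_lintegral_sub_floor (measurable_cons_left hκ _)).symm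
    _ = ∫⁻ t in Set.Ico (0 : ℝ) 1, ∫⁻ z, ∫⁻ s : ℝ,
          κ (Fin.cons (t - (⌊s⌋ : ℝ)) (subInt y (intPart z))) := by
        refine lintegral_lintegral_swap (Measurable.aemeasurable ?_)
        exact (hm.comp ((measurable_fst.comp measurable_fst).prodMk
          ((measurable_snd.comp measurable_fst).prodMk measurable_snd))).lintegral_prod_right'
    _ = _ := by
        refine lintegral_congr fun t => ?_
        simp only [latticeOp, Pi.one_apply, mul_one]
        rw [lintegral_cons (measurable_kernel hκ _)]
        simp_rw [subInt_cons, Fin.cons_zero, Fin.tail_cons]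

/-- The constant interpolates between the bound `M` on the periodization of the kernel and the
integral of the kernel. The power `s` makes the induction on the dimension work: Jensen's
inequality raises it to the innermost exponent, after which the innermost integration is
Tonelli's theorem, and monotonicity of `P` allows the next step. -/
theorem mixedLNorm_latticeOp_rpow_le {n : ℕ} {P : Fin n → ℝ} {s p : ℝ} (hs : 0 < s) (hsp : s ≤ p)
    (hsP : ∀ i, s ≤ P i) (hPp : ∀ i, P i ≤ p) (hmono : Monotone P) {κ h : (Fin n → ℝ) → ℝ≥0∞}
    (hκ : Measurable κ) (hh : Measurable h) {M : ℝ≥0∞} (hM : M ≠ ∞)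
    (hT : ∀ᵐ x, latticeOp κ 1 x ≤ M) :
    mixedLNorm n P (fun x => latticeOp κ (fun t => h t ^ s) x ^ (1 / s)) ≤
      M ^ (1 / s - 1 / p) * (∫⁻ x, κ x) ^ (1 / p) * mixedLNorm n P h := by
  induction n generalizing s with
  | zero =>
    have e : ∀ g : (Fin 0 → ℝ) → ℝ≥0∞, ∫⁻ t, g t = g Fin.elim0 := fun g => by
      have hvol : volume (Set.univ : Set (Fin 0 → ℝ)) = 1 := by
        rw [← Set.pi_univ Set.univ, volume_pi_pi]
        simp
      rw [lintegral_unique, hvol, mul_one]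
      exact congrArg g (Subsingleton.elim _ _)
    obtain ⟨x, hx⟩ := hT.exists
    have e2 : ∀ x : Fin 0 → ℝ, x = Fin.elim0 := fun x => Subsingleton.elim _ _
    simp only [mixedLNorm, latticeOp, e, e2 (subInt _ _), Pi.one_apply, mul_one] at hx ⊢
    have hp : 0 < p := hs.trans_le hsp
    have hexp : 0 ≤ 1 / s - 1 / p := sub_nonneg.2 (one_div_le_one_div_of_le hs hsp)
    rw [ENNReal.mul_rpow_of_nonneg _ _ (by positivity), ← ENNReal.rpow_mul,
      mul_one_div_cancel hs.ne', ENNReal.rpow_one]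
    refine mul_le_mul_left ?_ _
    calc κ Fin.elim0 ^ (1 / s) = κ Fin.elim0 ^ (1 / s - 1 / p) * κ Fin.elim0 ^ (1 / p) := by
          rw [← ENNReal.rpow_add_of_nonneg _ _ hexp (by positivity), sub_add_cancel]
      _ ≤ _ := mul_le_mul_left (ENNReal.rpow_le_rpow hx hexp) _
  | succ n ih =>
    have hq : 0 < P 0 := hs.trans_le (hsP 0)
    set q := P 0 with hqdef
    have hexp : 0 ≤ 1 / s - 1 / q := sub_nonneg.2 (one_div_le_one_div_of_le hs (hsP 0))
    have hexp' : 0 ≤ 1 / q - 1 / p := sub_nonneg.2 (one_div_le_one_div_of_le hq (hPp 0))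
    set κ' : (Fin n → ℝ) → ℝ≥0∞ := fun z => ∫⁻ t : ℝ, κ (Fin.cons t z) with hκ'
    set H : (Fin n → ℝ) → ℝ≥0∞ := fun z => (∫⁻ t : ℝ, h (Fin.cons t z) ^ q) ^ (1 / q) with hH
    have hT' : ∀ᵐ y, latticeOp κ' 1 y ≤ M := by
      filter_upwards [ae_ae_cons hT] with y hy
      rw [hκ', latticeOp_marginal_one hκ]
      calc ∫⁻ t in Set.Ico (0 : ℝ) 1, latticeOp κ 1 (Fin.cons t y)
          ≤ ∫⁻ _ in Set.Ico (0 : ℝ) 1, M := lintegral_mono_ae (ae_restrict_of_ae hy)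
        _ = M := by simp
    have key := ih (P := Fin.tail P) hq (hPp 0) (fun i => hmono (Fin.zero_le _)) (fun i => hPp _)
      (fun i j hij => hmono (Fin.succ_le_succ_iff.2 hij)) (measurable_lintegral_cons hκ)
      (measurable_lintegral_rpow_cons hh q) hT'
    have hc : M ^ (1 / s - 1 / q) ≠ ∞ := ENNReal.rpow_ne_top_of_nonneg hexp hM
    have hptP : ∀ i, 0 < Fin.tail P i := fun i => hs.trans_le (hsP _)
    calc mixedLNorm (n + 1) P (fun x => latticeOp κ (fun t => h t ^ s) x ^ (1 / s))
        ≤ mixedLNorm n (Fin.tail P) (fun y => M ^ (1 / s - 1 / q) *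
            latticeOp κ' (fun z => H z ^ q) y ^ (1 / q)) := by
          refine mixedLNorm_mono_ae (P := Fin.tail P) hptP ?_
          filter_upwards [ae_ae_cons hT] with y hy
          have h1 : ∫⁻ t : ℝ, (latticeOp κ (fun t => h t ^ s) (Fin.cons t y) ^ (1 / s)) ^ q ≤
              (M ^ (1 / s - 1 / q)) ^ q * latticeOp κ' (fun z => H z ^ q) y := by
            have h2 : (fun z => H z ^ q) = fun z => ∫⁻ t : ℝ, h (Fin.cons t z) ^ q := by
              ext z
              rw [hH, ← ENNReal.rpow_mul, one_div_mul_cancel hq.ne', ENNReal.rpow_one]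
            rw [h2, ← lintegral_latticeOp_cons hκ (hh.pow_const q), ← lintegral_const_mul' _ _
              (ENNReal.rpow_ne_top_of_nonneg hq.le hc)]
            refine lintegral_mono_ae ?_
            filter_upwards [hy] with t ht
            refine (ENNReal.rpow_le_rpow (latticeOp_rpow_le hκ hh hs (hsP 0) ht) hq.le).trans_eq ?_
            rw [ENNReal.mul_rpow_of_nonneg _ _ hq.le, ← ENNReal.rpow_mul (latticeOp _ _ _),
              one_div_mul_cancel hq.ne', ENNReal.rpow_one, mul_comm]
          refine (ENNReal.rpow_le_rpow h1 (by positivity)).trans_eq ?_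
          rw [ENNReal.mul_rpow_of_nonneg _ _ (by positivity), ← ENNReal.rpow_mul (M ^ _),
            mul_one_div_cancel hq.ne', ENNReal.rpow_one]
      _ = M ^ (1 / s - 1 / q) *
            mixedLNorm n (Fin.tail P) (fun y => latticeOp κ' (fun z => H z ^ q) y ^ (1 / q)) :=
          mixedLNorm_const_mul (P := Fin.tail P) hptP hc _
      _ ≤ M ^ (1 / s - 1 / q) * (M ^ (1 / q - 1 / p) * (∫⁻ y, κ' y) ^ (1 / p) *
            mixedLNorm n (Fin.tail P) H) := mul_le_mul_right key _
      _ = _ := by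
          rw [hκ', ← lintegral_cons hκ, ← mul_assoc, ← mul_assoc,
            ← ENNReal.rpow_add_of_nonneg _ _ hexp hexp', sub_add_sub_cancel]
          rfl

theorem mixedLNorm_latticeOp_dilate_le {n : ℕ} {P : Fin n → ℝ} {p : ℝ} (hp : 1 ≤ p)
    (hP : ∀ i, 1 ≤ P i) (hPp : ∀ i, P i ≤ p) (hmono : Monotone P) {κ h : (Fin n → ℝ) → ℝ≥0∞}
    (hκ : Measurable κ) (hh : Measurable h) {M : ℝ≥0∞} (hM : M ≠ ∞)
    (hT : ∀ᵐ x, latticeOp κ 1 x ≤ M) {w : ℝ} (hw : 0 < w) :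
    mixedLNorm n P (fun x => latticeOp κ (fun t => h (w⁻¹ • t)) (w • x)) ≤
      M ^ (1 - 1 / p) * (∫⁻ x, κ x) ^ (1 / p) * mixedLNorm n P h := by
  have hP0 : ∀ i, 0 < P i := fun i => one_pos.trans_le (hP i)
  obtain ⟨c, -, -, hc⟩ := exists_mixedLNorm_comp_smul hP0 hw
  have hmeas : Measurable fun t => h (w⁻¹ • t) := hh.comp (measurable_const_smul _)
  have key := mixedLNorm_latticeOp_rpow_le one_pos hp hP hPp hmono hκ hmeas hM hT
  simp only [ENNReal.rpow_one, div_one] at key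
  calc mixedLNorm n P (fun x => latticeOp κ (fun t => h (w⁻¹ • t)) (w • x))
      = c * mixedLNorm n P (latticeOp κ (fun t => h (w⁻¹ • t))) := hc _
    _ ≤ c * (M ^ (1 - 1 / p) * (∫⁻ x, κ x) ^ (1 / p) * mixedLNorm n P (fun t => h (w⁻¹ • t))) :=
        mul_le_mul_right key _
    _ = M ^ (1 - 1 / p) * (∫⁻ x, κ x) ^ (1 / p) * (c * mixedLNorm n P (fun t => h (w⁻¹ • t))) := by
        ring
    _ = _ := by
        rw [← hc fun t => h (w⁻¹ • t)]
        simp [inv_smul_smul₀ hw.ne']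

/-! ### Local integrability -/

theorem norm_subInt_intPart_sub_le {n : ℕ} (x t : Fin n → ℝ) :
    ‖subInt x (intPart t) - (x - t)‖ ≤ 1 := by
  refine (pi_norm_le_iff_of_nonneg zero_le_one).2 fun j => ?_
  have h1 := Int.floor_le (t j)
  have h2 := Int.lt_floor_add_one (t j)
  simp only [subInt, intPart, Pi.sub_apply, Real.norm_eq_abs]
  rw [abs_le]
  constructor <;> linarith

theorem latticeOp_indicator_closedBall_one_le {n : ℕ} (R : ℝ) (x : Fin n → ℝ) :
    latticeOp ((Metric.closedBall 0 R).indicator 1) 1 x ≤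
      volume (Metric.closedBall (0 : Fin n → ℝ) (R + 1)) := by
  rw [← Measure.addHaar_closedBall_center volume x,
    ← lintegral_indicator_one Metric.isClosed_closedBall.measurableSet]
  refine lintegral_mono fun t => ?_
  by_cases ht : subInt x (intPart t) ∈ Metric.closedBall (0 : Fin n → ℝ) R
  · have hmem : t ∈ Metric.closedBall x (R + 1) := by
      rw [mem_closedBall_zero_iff] at ht
      rw [Metric.mem_closedBall', dist_eq_norm]
      have h1 := norm_subInt_intPart_sub_le x t
      have h2 := norm_sub_norm_le (x - t) (subInt x (intPart t))
      rw [norm_sub_rev (x - t)] at h2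
      linarith
    simp [ht, hmem]
  · simp [ht]

theorem mixedLNorm_indicator_cell {n : ℕ} {P : Fin n → ℝ} (hP : ∀ i, 0 < P i) (k : Fin n → ℤ) :
    mixedLNorm n P ((cell k).indicator 1) = 1 := by
  rw [cell, mixedLNorm_indicator_pi hP (fun _ => measurableSet_Ico) (fun _ => by simp)]
  simp

theorem mixedLNorm_indicator_closedBall_lt_top {n : ℕ} {P : Fin n → ℝ} (hP : ∀ i, 0 < P i)
    {R : ℝ} (hR : 0 ≤ R) : mixedLNorm n P ((Metric.closedBall 0 R).indicator 1) < ∞ := by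
  rw [closedBall_pi _ hR, mixedLNorm_indicator_pi hP
    (fun _ => Metric.isClosed_closedBall.measurableSet) (fun _ => measure_closedBall_lt_top.ne)]
  refine ENNReal.prod_lt_top fun i _ => ?_
  have := hP i
  exact ENNReal.rpow_lt_top_of_nonneg (by positivity) measure_closedBall_lt_top.ne

/-- The integral over a ball is bounded by the mixed norm, uniformly over the balls of a given
radius centred at integer points: on the cell of the centre, the sampling operator of the
indicator of a larger ball dominates the integral. -/
theorem exists_setLIntegral_closedBall_le {n : ℕ} {P : Fin n → ℝ} {p : ℝ} (hp : 1 ≤ p)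
    (hP : ∀ i, 1 ≤ P i) (hPp : ∀ i, P i ≤ p) (hmono : Monotone P) (R : ℝ) :
    ∃ C : ℝ≥0∞, C ≠ ∞ ∧ ∀ (k : Fin n → ℤ) (h : (Fin n → ℝ) → ℝ≥0∞), Measurable h →
      ∫⁻ t in Metric.closedBall (fun j => (k j : ℝ)) R, h t ≤ C * mixedLNorm n P h := by
  have hP0 : ∀ i, 0 < P i := fun i => one_pos.trans_le (hP i)
  set κ : (Fin n → ℝ) → ℝ≥0∞ := (Metric.closedBall 0 (R + 2)).indicator 1 with hκdef
  have hκ : Measurable κ := measurable_one.indicator Metric.isClosed_closedBall.measurableSet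
  set M := volume (Metric.closedBall (0 : Fin n → ℝ) (R + 2 + 1)) with hMdef
  have hM : M ≠ ∞ := measure_closedBall_lt_top.ne
  have hT : ∀ᵐ x, latticeOp κ 1 x ≤ M :=
    Eventually.of_forall fun x => latticeOp_indicator_closedBall_one_le _ x
  have hint : ∫⁻ x, κ x ≠ ∞ := by
    rw [hκdef, lintegral_indicator_one Metric.isClosed_closedBall.measurableSet]
    exact measure_closedBall_lt_top.ne
  have hexp : 0 ≤ 1 - 1 / p := sub_nonneg.2 ((div_le_one (by linarith)).2 hp)
  refine ⟨M ^ (1 - 1 / p) * (∫⁻ x, κ x) ^ (1 / p), ENNReal.mul_ne_top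
    (ENNReal.rpow_ne_top_of_nonneg hexp hM)
    (ENNReal.rpow_ne_top_of_nonneg (by positivity) hint), fun k h hh => ?_⟩
  have key := mixedLNorm_latticeOp_dilate_le hp hP hPp hmono hκ hh hM hT one_pos
  simp only [inv_one, one_smul] at key
  refine le_trans ?_ key
  set c := ∫⁻ t in Metric.closedBall (fun j => (k j : ℝ)) R, h t with hc
  have hle : ∀ x, c * (cell k).indicator 1 x ≤ latticeOp κ h x := fun x => by
    by_cases hx : x ∈ cell k
    · simp only [hx, Set.indicator_of_mem, Pi.one_apply, mul_one]
      rw [hc, ← lintegral_indicator Metric.isClosed_closedBall.measurableSet]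
      refine lintegral_mono fun t => ?_
      by_cases ht : t ∈ Metric.closedBall (fun j => (k j : ℝ)) R
      · have h1 := norm_subInt_intPart_sub_le x t
        have h2 : ‖x - fun j => (k j : ℝ)‖ ≤ 1 := by
          refine (pi_norm_le_iff_of_nonneg zero_le_one).2 fun j => ?_
          have := hx j (Set.mem_univ j)
          rw [Pi.sub_apply, Real.norm_eq_abs, abs_le]
          constructor <;> linarith [this.1, this.2]
        have hmem : subInt x (intPart t) ∈ Metric.closedBall (0 : Fin n → ℝ) (R + 2) := by
          rw [mem_closedBall_zero_iff]
          rw [Metric.mem_closedBall', dist_eq_norm] at ht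
          have h3 := norm_add₃_le (a := subInt x (intPart t) - (x - t))
            (b := x - fun j => (k j : ℝ)) (c := (fun j => (k j : ℝ)) - t)
          rw [show subInt x (intPart t) - (x - t) + (x - fun j => (k j : ℝ)) +
            ((fun j => (k j : ℝ)) - t) = subInt x (intPart t) by abel] at h3
          linarith
        simp [ht, hκdef, hmem]
      · simp [ht]
    · simp [hx]
  -- `c` may be infinite a priori, so homogeneity is applied to the finite constants below it.
  refine ENNReal.le_of_forall_nnreal_lt fun r hr => ?_
  calc (r : ℝ≥0∞) = r * mixedLNorm n P ((cell k).indicator 1) := by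
        rw [mixedLNorm_indicator_cell hP0, mul_one]
    _ = mixedLNorm n P (fun x => r * (cell k).indicator 1 x) :=
        (mixedLNorm_const_mul hP0 ENNReal.coe_ne_top _).symm
    _ ≤ _ := mixedLNorm_mono hP0 fun x => (mul_le_mul_left hr.le _).trans (hle x)

theorem locallyIntegrable_of_mixedLNorm_lt_top {n : ℕ} {P : Fin n → ℝ} {p : ℝ} (hp : 1 ≤ p)
    (hP : ∀ i, 1 ≤ P i) (hPp : ∀ i, P i ≤ p) (hmono : Monotone P) {f : (Fin n → ℝ) → ℝ}
    (hf : Measurable f) (hfin : mixedNorm P f < ∞) : LocallyIntegrable f volume := by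
  intro x
  obtain ⟨C, hC, H⟩ := exists_setLIntegral_closedBall_le hp hP hPp hmono (‖x‖ + 1)
  have h0 : (fun j => (((0 : Fin n → ℤ) j : ℤ) : ℝ)) = (0 : Fin n → ℝ) := by ext j; simp
  have h1 := H 0 _ hf.enorm
  rw [h0] at h1
  refine ⟨Metric.closedBall 0 (‖x‖ + 1), Metric.closedBall_mem_nhds_of_mem ?_,
    hf.aestronglyMeasurable, h1.trans_lt (ENNReal.mul_lt_top hC.lt_top hfin)⟩
  rw [mem_ball_zero_iff]
  linarith

/-! ### Kernels -/

theorem IsKernel.exists_bound {n : ℕ} {α : ℝ} (hα : 0 ≤ α) {χ : (Fin n → ℝ) → ℝ}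
    (hχ : IsKernel α χ) : ∃ B : ℝ, ∀ u, |χ u| ≤ B := by
  obtain ⟨C, hC⟩ := hχ.bounded_near_zero
  obtain ⟨r, hr, hball⟩ := Metric.eventually_nhds_iff.1 hC
  set m := (absMoment α χ).toReal with hm
  have hm0 : 0 ≤ m := ENNReal.toReal_nonneg
  have hterm : ∀ u : Fin n → ℝ, |χ u| * ‖WithLp.toLp 2 u‖ ^ α ≤ m := fun u => by
    have h1 : ENNReal.ofReal (|χ u| * ‖WithLp.toLp 2 u‖ ^ α) ≤ absMoment α χ := by
      have h0 : subInt u 0 = u := by ext j; simp [subInt]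
      refine le_trans ?_ (le_iSup _ u)
      refine le_trans ?_ (ENNReal.le_tsum (0 : Fin n → ℤ))
      rw [h0]
    exact (ENNReal.ofReal_le_iff_le_toReal hχ.moment_lt_top.ne).1 h1
  refine ⟨max C (m / r ^ α), fun u => ?_⟩
  by_cases hu : ‖u‖ < r
  · exact (hball (by simpa using hu)).trans (le_max_left _ _)
  · refine le_trans ?_ (le_max_right _ _)
    rw [le_div_iff₀ (Real.rpow_pos_of_pos hr α)]
    refine le_trans (mul_le_mul_of_nonneg_left ?_ (abs_nonneg _)) (hterm u)
    refine Real.rpow_le_rpow hr.le ?_ hα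
    refine (not_lt.1 hu).trans ((pi_norm_le_iff_of_nonneg (norm_nonneg _)).2 fun j => ?_)
    exact PiLp.norm_apply_le (WithLp.toLp 2 u) j

/-- The moment of order `0` of a kernel is finite: far from the origin it is bounded by the moment
of order `α`, and only boundedly many integer translates are near the origin. -/
theorem IsKernel.exists_latticeOp_enorm_le {n : ℕ} {α : ℝ} (hα : 0 ≤ α) {χ : (Fin n → ℝ) → ℝ}
    (hχ : IsKernel α χ) :
    ∃ M : ℝ≥0∞, M ≠ ∞ ∧ ∀ u, latticeOp (fun x => ‖χ x‖ₑ) 1 u ≤ M := by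
  obtain ⟨B, hB⟩ := hχ.exists_bound hα
  refine ⟨absMoment α χ + ENNReal.ofReal B * volume (Metric.closedBall (0 : Fin n → ℝ) (1 + 1)),
    ENNReal.add_ne_top.2 ⟨hχ.moment_lt_top.ne, ENNReal.mul_ne_top ENNReal.ofReal_ne_top
      measure_closedBall_lt_top.ne⟩, fun u => ?_⟩
  have hpt : ∀ x : Fin n → ℝ, ‖χ x‖ₑ ≤ ENNReal.ofReal (|χ x| * ‖WithLp.toLp 2 x‖ ^ α) +
      ENNReal.ofReal B * (Metric.closedBall 0 1).indicator 1 x := fun x => by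
    rw [← ofReal_norm, Real.norm_eq_abs]
    by_cases hx : x ∈ Metric.closedBall (0 : Fin n → ℝ) 1
    · simp only [hx, Set.indicator_of_mem, Pi.one_apply, mul_one]
      exact le_add_left (ENNReal.ofReal_le_ofReal (hB x))
    · refine le_add_right (ENNReal.ofReal_le_ofReal ?_)
      refine le_mul_of_one_le_right (abs_nonneg _) (Real.one_le_rpow ?_ hα)
      rw [mem_closedBall_zero_iff, not_le] at hx
      refine hx.le.trans ((pi_norm_le_iff_of_nonneg (norm_nonneg _)).2 fun j => ?_)
      exact PiLp.norm_apply_le (WithLp.toLp 2 x) j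
  rw [latticeOp_one]
  calc ∑' k, ‖χ (subInt u k)‖ₑ ≤ _ := ENNReal.tsum_le_tsum fun k => hpt (subInt u k)
    _ = ∑' k, ENNReal.ofReal (|χ (subInt u k)| * ‖WithLp.toLp 2 (subInt u k)‖ ^ α) +
        ENNReal.ofReal B * latticeOp ((Metric.closedBall 0 1).indicator 1) 1 u := by
      rw [ENNReal.tsum_add, ENNReal.tsum_mul_left, latticeOp_one]
    _ ≤ _ := add_le_add (le_iSup (fun u : Fin n → ℝ => ∑' k,
        ENNReal.ofReal (|χ (subInt u k)| * ‖WithLp.toLp 2 (subInt u k)‖ ^ α)) u)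
        (mul_le_mul_right (latticeOp_indicator_closedBall_one_le 1 u) _)

theorem quasiMeasurePreserving_subInt {n : ℕ} (k : Fin n → ℤ) :
    Measure.QuasiMeasurePreserving (fun u : Fin n → ℝ => subInt u k) volume volume :=
  (measurePreserving_sub_right volume (fun j => (k j : ℝ))).quasiMeasurePreserving

/-- Almost everywhere, the integer translates of `|χ|` are those of a measurable function. -/
theorem exists_measurable_enorm_subInt_eq {n : ℕ} {χ : (Fin n → ℝ) → ℝ}
    (hχ : Integrable χ volume) :
    ∃ κ : (Fin n → ℝ) → ℝ≥0∞, Measurable κ ∧ ∫⁻ x, κ x ≠ ∞ ∧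
      ∀ᵐ u, ∀ k, ‖χ (subInt u k)‖ₑ = κ (subInt u k) := by
  have hm := hχ.aestronglyMeasurable.enorm
  refine ⟨hm.mk, hm.measurable_mk, ?_, ae_all_iff.2 fun k =>
    (quasiMeasurePreserving_subInt k).ae hm.ae_eq_mk⟩
  rw [← lintegral_congr_ae hm.ae_eq_mk]
  exact hχ.hasFiniteIntegral.ne

theorem latticeOp_congr_kernel {n : ℕ} {κ κ' : (Fin n → ℝ) → ℝ≥0∞} {u : Fin n → ℝ}
    (hu : ∀ k, κ (subInt u k) = κ' (subInt u k)) (h : (Fin n → ℝ) → ℝ≥0∞) :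
    latticeOp κ h u = latticeOp κ' h u := by
  simp only [latticeOp, hu]

/-! ### The Kantorovich operator -/

open scoped Pointwise in
theorem smul_cube {n : ℕ} {w : ℝ} (hw : 0 < w) (k : Fin n → ℤ) :
    w⁻¹ • (cube 1 k : Set (Fin n → ℝ)) = cube w k := by
  ext x
  rw [Set.mem_smul_set_iff_inv_smul_mem₀ (inv_ne_zero hw.ne'), inv_inv]
  simp only [cube, Set.mem_Icc, Pi.le_def, div_one, Pi.smul_apply, smul_eq_mul,
    div_le_iff₀' hw, le_div_iff₀' hw]

theorem kantorovichTerm_eq {n : ℕ} (χ : (Fin n → ℝ) → ℝ) {w : ℝ} (hw : 0 < w)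
    (f : (Fin n → ℝ) → ℝ) (x : Fin n → ℝ) (k : Fin n → ℤ) :
    kantorovichTerm χ w f x k = χ (subInt (w • x) k) * ∫ t in cell k, f (w⁻¹ • t) := by
  have h := Measure.setIntegral_comp_smul_of_pos volume f (cube 1 k) (inv_pos.2 hw)
  rw [smul_cube hw, Module.finrank_fin_fun, inv_pow, inv_inv, smul_eq_mul] at h
  rw [kantorovichTerm, ← h, setIntegral_congr_set (cube_ae_eq_cell k)]

theorem exists_setLIntegral_cell_le {n : ℕ} {P : Fin n → ℝ} {p : ℝ} (hp : 1 ≤ p)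
    (hP : ∀ i, 1 ≤ P i) (hPp : ∀ i, P i ≤ p) (hmono : Monotone P) {f : (Fin n → ℝ) → ℝ}
    (hf : Measurable f) (hfin : mixedNorm P f < ∞) {w : ℝ} (hw : 0 < w) :
    ∃ C : ℝ≥0∞, C ≠ ∞ ∧ ∀ k, ∫⁻ t in cell k, ‖f (w⁻¹ • t)‖ₑ ≤ C := by
  have hP0 : ∀ i, 0 < P i := fun i => one_pos.trans_le (hP i)
  obtain ⟨c, -, hc, H⟩ := exists_mixedLNorm_comp_smul hP0 (inv_pos.2 hw)
  obtain ⟨C, hC, HC⟩ := exists_setLIntegral_closedBall_le hp hP hPp hmono 1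
  refine ⟨C * (c * mixedNorm P f), ENNReal.mul_ne_top hC (ENNReal.mul_ne_top hc hfin.ne),
    fun k => ?_⟩
  rw [mixedNorm, ← H]
  refine le_trans (lintegral_mono_set fun x hx => ?_)
    (HC k _ (hf.comp (measurable_const_smul _)).enorm)
  refine (dist_pi_le_iff zero_le_one).2 fun j => ?_
  have := hx j (Set.mem_univ j)
  rw [Real.dist_eq, abs_le]
  constructor <;> linarith [this.1, this.2]

theorem summable_kantorovichTerm {n : ℕ} {χ : (Fin n → ℝ) → ℝ} {w : ℝ} (hw : 0 < w)
    {f : (Fin n → ℝ) → ℝ} {C : ℝ≥0∞} (hC : C ≠ ∞)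
    (hfC : ∀ k, ∫⁻ t in cell k, ‖f (w⁻¹ • t)‖ₑ ≤ C) {x : Fin n → ℝ}
    (hχ : Summable fun k : Fin n → ℤ => χ (subInt (w • x) k)) :
    Summable (kantorovichTerm χ w f x) := by
  refine Summable.of_norm_bounded (hχ.norm.mul_right C.toReal) fun k => ?_
  rw [kantorovichTerm_eq χ hw, norm_mul]
  refine mul_le_mul_of_nonneg_left ?_ (norm_nonneg _)
  rw [← toReal_enorm]
  exact ENNReal.toReal_mono hC ((enorm_integral_le_lintegral_enorm _).trans (hfC k))

/-- Since `∑ₖ χ(w x - k) = 1`, the operator reproduces constants, so that the distance of its value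
to a constant `c` is controlled by the sampling operator applied to `|f - c|`. -/
theorem enorm_kantorovich_sub_le {n : ℕ} {χ : (Fin n → ℝ) → ℝ} {w : ℝ} (hw : 0 < w)
    {f : (Fin n → ℝ) → ℝ} (hf : Measurable f) {C : ℝ≥0∞} (hC : C ≠ ∞)
    (hfC : ∀ k, ∫⁻ t in cell k, ‖f (w⁻¹ • t)‖ₑ ≤ C) {x : Fin n → ℝ}
    (hχ : HasSum (fun k : Fin n → ℤ => χ (subInt (w • x) k)) 1) (c : ℝ) :
    ‖kantorovich χ w f x - c‖ₑ ≤
      latticeOp (fun u => ‖χ u‖ₑ) (fun t => ‖f (w⁻¹ • t) - c‖ₑ) (w • x) := by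
  have hfw : Measurable fun t => f (w⁻¹ • t) := hf.comp (measurable_const_smul _)
  have hterm : ∀ k, kantorovichTerm χ w f x k - χ (subInt (w • x) k) * c =
      χ (subInt (w • x) k) * ∫ t in cell k, (f (w⁻¹ • t) - c) := fun k => by
    have hi : Integrable (fun t => f (w⁻¹ • t)) (volume.restrict (cell k)) :=
      ⟨hfw.aestronglyMeasurable, (hfC k).trans_lt hC.lt_top⟩
    have hfinite : IsFiniteMeasure (volume.restrict (cell k)) :=
      ⟨by simp [volume_cell]⟩
    rw [kantorovichTerm_eq χ hw, integral_sub hi (integrable_const c), integral_const]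
    simp [Measure.real, volume_cell]
    ring
  have hsum := (summable_kantorovichTerm hw hC hfC hχ.summable).hasSum.sub (hχ.mul_right c)
  rw [one_mul] at hsum
  simp only [hterm] at hsum
  rw [kantorovich, ← hsum.tsum_eq, latticeOp_eq_tsum _ (hfw.sub_const c).enorm]
  refine enorm_tsum_le_tsum_enorm.trans (ENNReal.tsum_le_tsum fun k => ?_)
  rw [enorm_mul]
  exact mul_le_mul_right (enorm_integral_le_lintegral_enorm _) _

theorem aestronglyMeasurable_kantorovich {n : ℕ} {χ : (Fin n → ℝ) → ℝ}
    (hχ : AEStronglyMeasurable χ volume) {w : ℝ} (hw : 0 < w) {f : (Fin n → ℝ) → ℝ}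
    (hsum : ∀ x, Summable (kantorovichTerm χ w f x)) :
    AEStronglyMeasurable (kantorovich χ w f) volume := by
  have hterm : ∀ k, AEStronglyMeasurable (fun x => kantorovichTerm χ w f x k) volume := fun k => by
    have hq : Measure.QuasiMeasurePreserving (fun x : Fin n → ℝ => subInt (w • x) k) volume
        volume := (quasiMeasurePreserving_subInt k).comp
      (Measure.quasiMeasurePreserving_smul volume hw.ne')
    exact (hχ.comp_quasiMeasurePreserving hq).mul_const _
  refine aestronglyMeasurable_of_tendsto_ae (atTop : Filter (Finset (Fin n → ℤ)))
    (f := fun s x => ∑ k ∈ s, kantorovichTerm χ w f x k) (fun s => ?_)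
    (Eventually.of_forall fun x => (hsum x).hasSum)
  exact Finset.aestronglyMeasurable_fun_sum s fun k _ => hterm k

/-! ### Density of continuous functions with compact support -/

theorem exists_hasCompactSupport_of_bounded {n : ℕ} {P : Fin n → ℝ} (hP : ∀ i, 0 < P i)
    {f : (Fin n → ℝ) → ℝ} (hf : Measurable f) {N : ℝ} (hN : 0 ≤ N) (hfN : ∀ x, |f x| ≤ N)
    (hsupp : ∀ x, N < ‖x‖ → f x = 0) {ε : ℝ≥0∞} (hε : ε ≠ 0) :
    ∃ g : (Fin n → ℝ) → ℝ, Continuous g ∧ HasCompactSupport g ∧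
      mixedNorm P (fun x => f x - g x) ≤ ε := by
  have hint : MemLp f 1 volume := by
    refine memLp_one_iff_integrable.2 ⟨hf.aestronglyMeasurable, ?_⟩
    have hle : ∀ x, ‖f x‖ₑ ≤ ENNReal.ofReal N *
        (Metric.closedBall (0 : Fin n → ℝ) N).indicator 1 x := fun x => by
      by_cases hx : x ∈ Metric.closedBall (0 : Fin n → ℝ) N
      · simp only [hx, Set.indicator_of_mem, Pi.one_apply, mul_one]
        rw [← ofReal_norm]
        exact ENNReal.ofReal_le_ofReal (hfN x)
      · rw [mem_closedBall_zero_iff, not_le] at hx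
        simp [hsupp x hx]
    refine (lintegral_mono hle).trans_lt ?_
    rw [lintegral_const_mul' _ _ ENNReal.ofReal_ne_top,
      lintegral_indicator_one Metric.isClosed_closedBall.measurableSet]
    exact ENNReal.mul_lt_top ENNReal.ofReal_lt_top measure_closedBall_lt_top
  -- Continuous functions converging to `f` in `L¹`, hence almost everywhere along a subsequence.
  have happrox : ∀ j : ℕ, ∃ g : (Fin n → ℝ) → ℝ, Continuous g ∧
      eLpNorm (f - g) 1 volume ≤ ENNReal.ofReal (1 / ((j : ℝ) + 1)) := fun j => by
    obtain ⟨g, -, h2, h3, -⟩ := hint.exists_hasCompactSupport_eLpNorm_sub_le ENNReal.one_ne_top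
      (ε := ENNReal.ofReal (1 / ((j : ℝ) + 1))) (by
        rw [ne_eq, ENNReal.ofReal_eq_zero, not_le]
        positivity)
    exact ⟨g, h3, h2⟩
  choose G hGc hG using happrox
  have hlim : Tendsto (fun j => eLpNorm (G j - f) 1 volume) atTop (𝓝 0) := by
    have h0 := ENNReal.tendsto_ofReal (tendsto_one_div_add_atTop_nhds_zero_nat (𝕜 := ℝ))
    rw [ENNReal.ofReal_zero] at h0
    refine tendsto_of_tendsto_of_tendsto_of_le_of_le tendsto_const_nhds h0
      (fun _ => zero_le) fun j => ?_
    rw [eLpNorm_sub_comm]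
    exact hG j
  obtain ⟨ns, -, hns⟩ := (tendstoInMeasure_of_tendsto_eLpNorm one_ne_zero
    (fun j => (hGc j).aestronglyMeasurable) hf.aestronglyMeasurable hlim).exists_seq_tendsto_ae
  -- Clipping to `[-N, N]` and a cut-off make dominated convergence applicable.
  set φ : (Fin n → ℝ) → ℝ := fun x => max 0 (min 1 (N + 1 - ‖x‖)) with hφ
  have hφc : Continuous φ := by fun_prop
  have hφ0 : ∀ x, 0 ≤ φ x := fun x => le_max_left _ _
  have hφ1 : ∀ x, φ x ≤ 1 := fun x => max_le zero_le_one (min_le_left _ _)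
  have hφN : ∀ x, ‖x‖ ≤ N → φ x = 1 := fun x hx => by
    rw [hφ]
    simp only
    rw [min_eq_left (by linarith), max_eq_right zero_le_one]
  have hφs : ∀ x, N + 1 < ‖x‖ → φ x = 0 := fun x hx =>
    max_eq_left ((min_le_right _ _).trans (by linarith))
  set H : ℕ → (Fin n → ℝ) → ℝ := fun j x => max (-N) (min N (G (ns j) x)) * φ x with hH
  have hHc : ∀ j, Continuous (H j) := fun j => by
    have := hGc (ns j)
    fun_prop
  have hHs : ∀ j x, N + 1 < ‖x‖ → H j x = 0 := fun j x hx => by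
    simp only [hH, hφs x hx, mul_zero]
  have hHN : ∀ j x, |H j x| ≤ N := fun j x => by
    rw [hH]
    simp only
    rw [abs_mul, abs_of_nonneg (hφ0 x)]
    refine (mul_le_of_le_one_right (abs_nonneg _) (hφ1 x)).trans (abs_le.2 ⟨le_max_left _ _, ?_⟩)
    exact max_le (by linarith) (min_le_left _ _)
  have hfφ : ∀ x, max (-N) (min N (f x)) * φ x = f x := fun x => by
    have h1 := abs_le.1 (hfN x)
    rw [min_eq_right h1.2, max_eq_right h1.1]
    rcases le_or_gt ‖x‖ N with hx | hx
    · rw [hφN x hx, mul_one]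
    · rw [hsupp x hx, zero_mul]
  have key := tendsto_mixedLNorm_zero_of_dominated hP (F := fun j x => ‖f x - H j x‖ₑ)
    (G := fun x => ENNReal.ofReal (N + N) * (Metric.closedBall 0 (N + 1)).indicator 1 x)
    (fun j => (hf.sub (hHc j).measurable).enorm)
    ((measurable_one.indicator Metric.isClosed_closedBall.measurableSet).const_mul _)
    (fun j => Eventually.of_forall fun x => by
      by_cases hx : x ∈ Metric.closedBall (0 : Fin n → ℝ) (N + 1)
      · simp only [hx, Set.indicator_of_mem, Pi.one_apply, mul_one]
        rw [← ofReal_norm]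
        exact ENNReal.ofReal_le_ofReal ((abs_sub _ _).trans (add_le_add (hfN x) (hHN j x)))
      · rw [mem_closedBall_zero_iff, not_le] at hx
        simp [hHs j x hx, hsupp x (by linarith)])
    (by
      rw [mixedLNorm_const_mul hP ENNReal.ofReal_ne_top]
      exact ENNReal.mul_lt_top ENNReal.ofReal_lt_top
        (mixedLNorm_indicator_closedBall_lt_top hP (by linarith)))
    (by
      filter_upwards [hns] with x hx
      have hcl : Tendsto (fun j => H j x) atTop (𝓝 (f x)) := by
        rw [← hfφ x]
        exact (tendsto_const_nhds.max (tendsto_const_nhds.min hx)).mul_const _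
      have := (tendsto_const_nhds (x := f x)).sub hcl
      rw [sub_self] at this
      simpa using this.enorm)
  obtain ⟨j, hj⟩ := (ENNReal.tendsto_nhds_zero.1 key ε (pos_iff_ne_zero.2 hε)).exists
  refine ⟨H j, hHc j, HasCompactSupport.intro (isCompact_closedBall 0 (N + 1)) fun x hx => ?_, hj⟩
  rw [mem_closedBall_zero_iff, not_le] at hx
  exact hHs j x hx

theorem exists_hasCompactSupport_mixedNorm_sub_le {n : ℕ} {P : Fin n → ℝ} (hP : ∀ i, 1 ≤ P i)
    {f : (Fin n → ℝ) → ℝ} (hf : Measurable f) (hfin : mixedNorm P f < ∞) {ε : ℝ≥0∞}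
    (hε : ε ≠ 0) :
    ∃ g : (Fin n → ℝ) → ℝ, Continuous g ∧ HasCompactSupport g ∧
      mixedNorm P (fun x => f x - g x) ≤ ε := by
  have hP0 : ∀ i, 0 < P i := fun i => one_pos.trans_le (hP i)
  set S : ℕ → Set (Fin n → ℝ) := fun N => {x | |f x| ≤ N ∧ ‖x‖ ≤ N} with hS
  have hSm : ∀ N, MeasurableSet (S N) := fun N =>
    (measurableSet_le hf.abs measurable_const).inter (measurableSet_le measurable_norm
      measurable_const)
  have key := tendsto_mixedLNorm_zero_of_dominated hP0
    (F := fun N x => ‖f x - (S N).indicator f x‖ₑ) (G := fun x => ‖f x‖ₑ)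
    (fun N => (hf.sub (hf.indicator (hSm N))).enorm) hf.enorm
    (fun N => Eventually.of_forall fun x => by by_cases hx : x ∈ S N <;> simp [hx]) hfin
    (Eventually.of_forall fun x => by
      obtain ⟨N0, hN0⟩ := exists_nat_ge (max |f x| ‖x‖)
      refine tendsto_const_nhds.congr' ?_
      filter_upwards [eventually_ge_atTop N0] with N hN
      have hN' : max |f x| ‖x‖ ≤ N := hN0.trans (by exact_mod_cast hN)
      have hx : x ∈ S N := max_le_iff.1 hN'
      simp [hx])
  have hε2 : 0 < ε / 2 := ENNReal.half_pos hε
  obtain ⟨N, hN⟩ := (ENNReal.tendsto_nhds_zero.1 key (ε / 2) hε2).exists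
  obtain ⟨g, hg1, hg2, hg3⟩ := exists_hasCompactSupport_of_bounded hP0 (hf.indicator (hSm N))
    (N := N) N.cast_nonneg
    (fun x => by
      by_cases hx : x ∈ S N
      · simpa [hx] using hx.1
      · simp [hx])
    (fun x hx => Set.indicator_of_notMem (fun h => absurd h.2 (not_le.2 hx)) _) hε2.ne'
  refine ⟨g, hg1, hg2, ?_⟩
  calc mixedNorm P (fun x => f x - g x)
      ≤ mixedLNorm n P (fun x => ‖f x - (S N).indicator f x‖ₑ + ‖(S N).indicator f x - g x‖ₑ) := by
        refine mixedLNorm_mono hP0 fun x => ?_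
        change ‖f x - g x‖ₑ ≤ _
        rw [← sub_add_sub_cancel (f x) ((S N).indicator f x) (g x)]
        exact enorm_add_le _ _
    _ ≤ _ := mixedLNorm_add_le hP (hf.sub (hf.indicator (hSm N))).enorm
        ((hf.indicator (hSm N)).sub hg1.measurable).enorm
    _ ≤ ε / 2 + ε / 2 := add_le_add hN hg3
    _ = ε := ENNReal.add_halves ε

/-! ### Kernels with small integral -/

theorem subInt_subInt {n : ℕ} (u : Fin n → ℝ) (k l : Fin n → ℤ) :
    subInt (subInt u k) l = subInt u (k + l) := by
  ext j
  simp [subInt, sub_sub]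

theorem latticeOp_one_subInt {n : ℕ} (κ : (Fin n → ℝ) → ℝ≥0∞) (u : Fin n → ℝ) (k : Fin n → ℤ) :
    latticeOp κ 1 (subInt u k) = latticeOp κ 1 u := by
  rw [latticeOp_one, latticeOp_one]
  simp only [subInt_subInt]
  exact (Equiv.addLeft k).tsum_eq fun l => κ (subInt u l)

/-- Moving the mass of the periodization of `κ` to the unit cell gives a kernel with the same
integral whose sampling operator is the product of that periodization with the local average. -/
theorem latticeOp_indicator_cell {n : ℕ} (κ : (Fin n → ℝ) → ℝ≥0∞) {h : (Fin n → ℝ) → ℝ≥0∞}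
    (hh : Measurable h) (u : Fin n → ℝ) :
    latticeOp ((cell 0).indicator (latticeOp κ 1)) h u =
      latticeOp κ 1 u * ∫⁻ t in cell (intPart u), h t := by
  have hmem : ∀ k, subInt u k ∈ cell 0 ↔ k = intPart u := fun k => by
    rw [← intPart_eq_iff, funext_iff, funext_iff]
    refine forall_congr' fun j => ?_
    simp only [intPart, subInt, Int.floor_sub_intCast, Pi.zero_apply]
    omega
  rw [latticeOp_eq_tsum _ hh, tsum_eq_single (intPart u) fun k hk => ?_]
  · rw [Set.indicator_of_mem ((hmem _).2 rfl), latticeOp_one_subInt]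
  · rw [Set.indicator_of_notMem (fun hc => hk ((hmem k).1 hc)), zero_mul]

/-- Restricted to a ball, the rescaled periodization of a kernel with small integral has small mixed
norm, uniformly in the scale. -/
theorem mixedLNorm_closedBall_mul_periodization_le {n : ℕ} {P : Fin n → ℝ} {p : ℝ} (hp : 1 ≤ p)
    (hP : ∀ i, 1 ≤ P i) (hPp : ∀ i, P i ≤ p) (hmono : Monotone P) {κ : (Fin n → ℝ) → ℝ≥0∞}
    (hκ : Measurable κ) {M : ℝ≥0∞} (hM : M ≠ ∞) (hT : ∀ᵐ x, latticeOp κ 1 x ≤ M) {w : ℝ}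
    (hw : 1 ≤ w) (L : ℝ) :
    mixedLNorm n P (fun x => (Metric.closedBall 0 L).indicator 1 x * latticeOp κ 1 (w • x)) ≤
      M ^ (1 - 1 / p) * (∫⁻ x, κ x) ^ (1 / p) *
        mixedLNorm n P ((Metric.closedBall 0 (L + 1)).indicator 1) := by
  have hw0 : 0 < w := one_pos.trans_le hw
  have hP0 : ∀ i, 0 < P i := fun i => one_pos.trans_le (hP i)
  set ψ : (Fin n → ℝ) → ℝ≥0∞ := (cell 0).indicator (latticeOp κ 1) with hψ
  have hψm : Measurable ψ :=
    (measurable_latticeOp hκ measurable_one).indicator (measurableSet_cell 0)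
  have hψint : ∫⁻ x, ψ x = ∫⁻ x, κ x := by
    rw [hψ, lintegral_indicator (measurableSet_cell 0), setLIntegral_cell_latticeOp_one hκ]
  have hψT : ∀ᵐ x, latticeOp ψ 1 x ≤ M := by
    filter_upwards [hT] with x hx
    rw [hψ, latticeOp_indicator_cell κ measurable_one]
    simpa [volume_cell] using hx
  have hB : Measurable
      ((Metric.closedBall (0 : Fin n → ℝ) (L + 1)).indicator (1 : (Fin n → ℝ) → ℝ≥0∞)) :=
    measurable_one.indicator Metric.isClosed_closedBall.measurableSet
  rw [← hψint]
  refine le_trans (mixedLNorm_mono hP0 fun x => ?_)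
    (mixedLNorm_latticeOp_dilate_le hp hP hPp hmono hψm hB hM hψT hw0)
  by_cases hx : x ∈ Metric.closedBall (0 : Fin n → ℝ) L
  · have hBw : Measurable fun t : Fin n → ℝ =>
        (Metric.closedBall (0 : Fin n → ℝ) (L + 1)).indicator (1 : (Fin n → ℝ) → ℝ≥0∞) (w⁻¹ • t) :=
      hB.comp (measurable_const_smul _)
    rw [hψ, latticeOp_indicator_cell κ hBw,
      Set.indicator_of_mem hx, Pi.one_apply, one_mul]
    refine le_mul_of_one_le_right zero_le ?_
    rw [← volume_cell (intPart (w • x)), ← setLIntegral_one]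
    refine setLIntegral_mono' (measurableSet_cell _) fun t ht => ?_
    have h1 : ‖t - w • x‖ ≤ 1 := by
      refine (pi_norm_le_iff_of_nonneg zero_le_one).2 fun j => ?_
      have h2 := ht j (Set.mem_univ j)
      have h3 := Int.floor_le ((w • x) j)
      have h4 := Int.lt_floor_add_one ((w • x) j)
      rw [Pi.sub_apply, Real.norm_eq_abs, abs_le]
      simp only [intPart] at h2
      constructor <;> linarith [h2.1, h2.2]
    have h5 : ‖w⁻¹ • t - x‖ ≤ 1 := by
      rw [show w⁻¹ • t - x = w⁻¹ • (t - w • x) by rw [smul_sub, inv_smul_smul₀ hw0.ne'], norm_smul,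
        Real.norm_eq_abs, abs_of_pos (inv_pos.2 hw0)]
      exact mul_le_one₀ (inv_le_one_of_one_le₀ hw) (norm_nonneg _) h1
    have h6 : w⁻¹ • t ∈ Metric.closedBall (0 : Fin n → ℝ) (L + 1) := by
      rw [mem_closedBall_zero_iff] at hx ⊢
      have := norm_sub_norm_le (w⁻¹ • t) x
      linarith
    rw [Set.indicator_of_mem h6, Pi.one_apply]
  · simp [hx]

theorem mixedLNorm_latticeOp_sub_le {n : ℕ} {P : Fin n → ℝ} {p : ℝ} (hp : 1 ≤ p)
    (hP : ∀ i, 1 ≤ P i) (hPp : ∀ i, P i ≤ p) (hmono : Monotone P) {κ : (Fin n → ℝ) → ℝ≥0∞}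
    (hκ : Measurable κ) {M : ℝ≥0∞} (hM : M ≠ ∞) (hT : ∀ᵐ x, latticeOp κ 1 x ≤ M)
    {g : (Fin n → ℝ) → ℝ} (hg : Measurable g) {N L : ℝ} (hgN : ∀ x, |g x| ≤ N)
    (hgL : ∀ x, L < ‖x‖ → g x = 0) {w : ℝ} (hw : 1 ≤ w) :
    mixedLNorm n P (fun x => latticeOp κ (fun t => ‖g (w⁻¹ • t) - g x‖ₑ) (w • x)) ≤
      M ^ (1 - 1 / p) * (mixedNorm P g + ENNReal.ofReal N *
        mixedLNorm n P ((Metric.closedBall 0 (L + 1)).indicator 1)) * (∫⁻ x, κ x) ^ (1 / p) := by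
  have hw0 : 0 < w := one_pos.trans_le hw
  have hP0 : ∀ i, 0 < P i := fun i => one_pos.trans_le (hP i)
  have hgw : Measurable fun t => ‖g (w⁻¹ • t)‖ₑ := (hg.comp (measurable_const_smul _)).enorm
  have hB : Measurable ((Metric.closedBall (0 : Fin n → ℝ) L).indicator (1 : (Fin n → ℝ) → ℝ≥0∞)) :=
    measurable_one.indicator Metric.isClosed_closedBall.measurableSet
  calc _ ≤ mixedLNorm n P (fun x => latticeOp κ (fun t => ‖g (w⁻¹ • t)‖ₑ) (w • x) +
        ENNReal.ofReal N *
          ((Metric.closedBall 0 L).indicator 1 x * latticeOp κ 1 (w • x))) := by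
        refine mixedLNorm_mono hP0 fun x => ?_
        have h1 : ‖g x‖ₑ ≤ ENNReal.ofReal N * (Metric.closedBall 0 L).indicator 1 x := by
          by_cases hx : x ∈ Metric.closedBall (0 : Fin n → ℝ) L
          · simp only [hx, Set.indicator_of_mem, Pi.one_apply, mul_one]
            rw [← ofReal_norm]
            exact ENNReal.ofReal_le_ofReal (hgN x)
          · rw [mem_closedBall_zero_iff, not_le] at hx
            simp [hgL x hx]
        calc _ ≤ latticeOp κ (fun t => ‖g (w⁻¹ • t)‖ₑ + ‖g x‖ₑ) (w • x) :=
              latticeOp_mono (fun _ => le_rfl) (fun t => enorm_sub_le) _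
          _ = latticeOp κ (fun t => ‖g (w⁻¹ • t)‖ₑ) (w • x) + latticeOp κ 1 (w • x) * ‖g x‖ₑ := by
              rw [latticeOp_add hκ hgw, latticeOp_const hκ]
          _ ≤ _ := by
              refine add_le_add le_rfl ?_
              rw [← mul_assoc, mul_comm]
              exact mul_le_mul_left h1 _
    _ ≤ mixedLNorm n P (fun x => latticeOp κ (fun t => ‖g (w⁻¹ • t)‖ₑ) (w • x)) +
        mixedLNorm n P (fun x => ENNReal.ofReal N *
          ((Metric.closedBall 0 L).indicator 1 x * latticeOp κ 1 (w • x))) := by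
        refine mixedLNorm_add_le hP
          ((measurable_latticeOp hκ hgw).comp (measurable_const_smul _)) ?_
        exact (hB.mul ((measurable_latticeOp hκ measurable_one).comp
          (measurable_const_smul _))).const_mul _
    _ ≤ M ^ (1 - 1 / p) * (∫⁻ x, κ x) ^ (1 / p) * mixedNorm P g + ENNReal.ofReal N *
        (M ^ (1 - 1 / p) * (∫⁻ x, κ x) ^ (1 / p) *
          mixedLNorm n P ((Metric.closedBall 0 (L + 1)).indicator 1)) := by
        refine add_le_add (mixedLNorm_latticeOp_dilate_le hp hP hPp hmono hκ hg.enorm hM hT hw0) ?_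
        rw [mixedLNorm_const_mul hP0 ENNReal.ofReal_ne_top]
        exact mul_le_mul_right
          (mixedLNorm_closedBall_mul_periodization_le hp hP hPp hmono hκ hM hT hw L) _
    _ = _ := by ring

/-! ### Convergence -/

/-- The part of the kernel in a ball only sees increments of `g` over small distances. -/
theorem latticeOp_closedBall_sub_le {n : ℕ} {κ : (Fin n → ℝ) → ℝ≥0∞} (hκ : Measurable κ)
    {g : (Fin n → ℝ) → ℝ} {L R η ω : ℝ} (hgL : ∀ x, L < ‖x‖ → g x = 0)
    (hg : ∀ x y, ‖x - y‖ < η → |g x - g y| ≤ ω) {w : ℝ} (hw : 0 < w) (hwη : R + 1 < w * η)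
    (hw1 : R + 1 < w) (x : Fin n → ℝ) :
    latticeOp ((Metric.closedBall 0 R).indicator κ) (fun t => ‖g (w⁻¹ • t) - g x‖ₑ) (w • x) ≤
      latticeOp κ 1 (w • x) *
        (ENNReal.ofReal ω * (Metric.closedBall 0 (L + 1)).indicator 1 x) := by
  rw [← latticeOp_const hκ]
  refine lintegral_mono fun t => ?_
  by_cases ht : subInt (w • x) (intPart t) ∈ Metric.closedBall (0 : Fin n → ℝ) R
  · rw [Set.indicator_of_mem ht]
    refine mul_le_mul_right ?_ _
    beta_reduce
    have h1 : ‖w⁻¹ • t - x‖ * w ≤ R + 1 := by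
      rw [show w⁻¹ • t - x = w⁻¹ • (t - w • x) by rw [smul_sub, inv_smul_smul₀ hw.ne'], norm_smul,
        Real.norm_eq_abs, abs_of_pos (inv_pos.2 hw), mul_comm, mul_inv_cancel_left₀ hw.ne',
        norm_sub_rev]
      rw [mem_closedBall_zero_iff] at ht
      have h2 := norm_subInt_intPart_sub_le (w • x) t
      have h3 := norm_sub_norm_le (w • x - t) (subInt (w • x) (intPart t))
      rw [norm_sub_rev (w • x - t)] at h3
      linarith
    by_cases hx : x ∈ Metric.closedBall (0 : Fin n → ℝ) (L + 1)
    · rw [Set.indicator_of_mem hx, Pi.one_apply, mul_one, ← ofReal_norm]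
      refine ENNReal.ofReal_le_ofReal (hg _ _ ?_)
      refine lt_of_mul_lt_mul_right ?_ hw.le
      linarith [mul_comm w η]
    · rw [mem_closedBall_zero_iff, not_le] at hx
      have h4 : ‖w⁻¹ • t - x‖ < 1 := by
        refine lt_of_mul_lt_mul_right ?_ hw.le
        linarith
      have h5 := norm_sub_norm_le x (w⁻¹ • t)
      rw [norm_sub_rev] at h5
      rw [hgL x (by linarith), hgL (w⁻¹ • t) (by linarith)]
      simp
  · simp [ht]

theorem measurable_latticeOp_sub {n : ℕ} {κ : (Fin n → ℝ) → ℝ≥0∞} (hκ : Measurable κ)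
    {g : (Fin n → ℝ) → ℝ} (hg : Measurable g) (w : ℝ) :
    Measurable fun x => latticeOp κ (fun t => ‖g (w⁻¹ • t) - g x‖ₑ) (w • x) := by
  have h1 : Measurable fun q : (Fin n → ℝ) × (Fin n → ℝ) => κ (subInt (w • q.1) (intPart q.2)) :=
    (hκ.comp measurable_subInt_intPart).comp
      ((measurable_fst.const_smul w).prodMk measurable_snd)
  have h2 : Measurable fun q : (Fin n → ℝ) × (Fin n → ℝ) => ‖g (w⁻¹ • q.2) - g q.1‖ₑ :=
    ((hg.comp (measurable_snd.const_smul w⁻¹)).sub (hg.comp measurable_fst)).enorm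
  exact (h1.mul h2).lintegral_prod_right'

theorem latticeOp_eq_add_compl {n : ℕ} {κ h : (Fin n → ℝ) → ℝ≥0∞} (hκ : Measurable κ)
    (hh : Measurable h) {S : Set (Fin n → ℝ)} (hS : MeasurableSet S) (x : Fin n → ℝ) :
    latticeOp κ h x = latticeOp (S.indicator κ) h x + latticeOp (Sᶜ.indicator κ) h x := by
  have hm : Measurable fun t => S.indicator κ (subInt x (intPart t)) * h t :=
    (measurable_kernel (hκ.indicator hS) x).mul hh
  rw [latticeOp, latticeOp, latticeOp, ← lintegral_add_left hm]
  refine lintegral_congr fun t => ?_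
  rw [← add_mul, ← Pi.add_apply, Set.indicator_self_add_compl]

theorem tendsto_lintegral_compl_closedBall {n : ℕ} {κ : (Fin n → ℝ) → ℝ≥0∞} (hκ : Measurable κ)
    (hint : ∫⁻ x, κ x ≠ ∞) :
    Tendsto (fun R : ℕ => ∫⁻ x, (Metric.closedBall (0 : Fin n → ℝ) R)ᶜ.indicator κ x) atTop
      (𝓝 0) := by
  have key := tendsto_lintegral_of_dominated_convergence (μ := volume)
    (F := fun (R : ℕ) x => (Metric.closedBall (0 : Fin n → ℝ) R)ᶜ.indicator κ x)
    (f := fun _ => 0) κ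
    (fun R => hκ.indicator Metric.isClosed_closedBall.measurableSet.compl)
    (fun R => Eventually.of_forall fun x => Set.indicator_le_self _ _ _) hint
    (Eventually.of_forall fun x => by
      obtain ⟨R0, hR0⟩ := exists_nat_ge ‖x‖
      refine tendsto_const_nhds.congr' ?_
      filter_upwards [eventually_ge_atTop R0] with R hR
      have hx : ‖x‖ ≤ R := hR0.trans (by exact_mod_cast hR)
      simp [hx])
  simpa using key

theorem tendsto_mixedLNorm_latticeOp_sub_of_hasCompactSupport {n : ℕ} {P : Fin n → ℝ} {p : ℝ}
    (hp : 1 ≤ p) (hP : ∀ i, 1 ≤ P i) (hPp : ∀ i, P i ≤ p) (hmono : Monotone P)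
    {κ : (Fin n → ℝ) → ℝ≥0∞} (hκ : Measurable κ) (hint : ∫⁻ x, κ x ≠ ∞) {M : ℝ≥0∞} (hM : M ≠ ∞)
    (hT : ∀ᵐ x, latticeOp κ 1 x ≤ M) {g : (Fin n → ℝ) → ℝ} (hg : Continuous g)
    (hgs : HasCompactSupport g) :
    Tendsto (fun w : ℝ => mixedLNorm n P
      (fun x => latticeOp κ (fun t => ‖g (w⁻¹ • t) - g x‖ₑ) (w • x))) atTop (𝓝 0) := by
  have hP0 : ∀ i, 0 < P i := fun i => one_pos.trans_le (hP i)
  have hp0 : 0 < p := one_pos.trans_le hp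
  obtain ⟨N, hN⟩ := hg.bounded_above_of_compact_support hgs
  obtain ⟨L, hL0, hL⟩ : ∃ L : ℝ, 0 ≤ L ∧ ∀ x, L < ‖x‖ → g x = 0 := by
    obtain ⟨L, hL⟩ := hgs.isCompact.isBounded.subset_closedBall (0 : Fin n → ℝ)
    refine ⟨max L 0, le_max_right _ _, fun x hx => image_eq_zero_of_notMem_tsupport fun hc => ?_⟩
    have := hL hc
    rw [mem_closedBall_zero_iff] at this
    exact absurd (this.trans (le_max_left _ _)) (not_le.2 hx)
  set B := mixedLNorm n P ((Metric.closedBall 0 (L + 1)).indicator 1) with hB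
  have hBfin : B < ∞ := mixedLNorm_indicator_closedBall_lt_top hP0 (by linarith)
  have hBm : Measurable
      ((Metric.closedBall (0 : Fin n → ℝ) (L + 1)).indicator (1 : (Fin n → ℝ) → ℝ≥0∞)) :=
    measurable_one.indicator Metric.isClosed_closedBall.measurableSet
  have hgfin : mixedNorm P g < ∞ := by
    refine lt_of_le_of_lt (mixedLNorm_mono hP0 (h := fun x =>
      ENNReal.ofReal N * (Metric.closedBall 0 (L + 1)).indicator 1 x) fun x => ?_) ?_
    · by_cases hx : x ∈ Metric.closedBall (0 : Fin n → ℝ) (L + 1)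
      · simp only [hx, Set.indicator_of_mem, Pi.one_apply, mul_one]
        rw [← ofReal_norm]
        exact ENNReal.ofReal_le_ofReal (hN x)
      · rw [mem_closedBall_zero_iff, not_le] at hx
        simp [hL x (by linarith)]
    · rw [mixedLNorm_const_mul hP0 ENNReal.ofReal_ne_top]
      exact ENNReal.mul_lt_top ENNReal.ofReal_lt_top hBfin
  set D := M ^ (1 - 1 / p) * (mixedNorm P g + ENNReal.ofReal N * B) with hD
  have hDfin : D ≠ ∞ := ENNReal.mul_ne_top
    (ENNReal.rpow_ne_top_of_nonneg (sub_nonneg.2 ((div_le_one hp0).2 hp)) hM)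
    (ENNReal.add_ne_top.2 ⟨hgfin.ne, ENNReal.mul_ne_top ENNReal.ofReal_ne_top hBfin.ne⟩)
  refine ENNReal.tendsto_nhds_zero.2 fun ε hε => ?_
  have hε2 : 0 < ε / 2 := ENNReal.half_pos hε.ne'
  -- The radius makes the contribution of the far part of the kernel small at all scales `w ≥ 1`.
  obtain ⟨R, hR⟩ : ∃ R : ℕ,
      D * (∫⁻ x, (Metric.closedBall (0 : Fin n → ℝ) R)ᶜ.indicator κ x) ^ (1 / p) ≤ ε / 2 := by
    have h1 := (ENNReal.continuous_rpow_const (y := 1 / p)).continuousAt.tendsto.comp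
      (tendsto_lintegral_compl_closedBall hκ hint)
    rw [ENNReal.zero_rpow_of_pos (by positivity)] at h1
    have h2 := ENNReal.Tendsto.const_mul h1 (Or.inr hDfin)
    rw [mul_zero] at h2
    exact (ENNReal.tendsto_nhds_zero.1 h2 _ hε2).exists
  obtain ⟨ω, hω0, hω⟩ := ENNReal.exists_nnreal_pos_mul_lt
    (ENNReal.mul_ne_top hM hBfin.ne) hε2.ne'
  obtain ⟨η, hη, hgη⟩ := Metric.uniformContinuous_iff.1
    (hgs.uniformContinuous_of_continuous hg) ω hω0
  have hgη' : ∀ x y, ‖x - y‖ < η → |g x - g y| ≤ ω := fun x y hxy => by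
    have := hgη (a := x) (b := y) (by rwa [dist_eq_norm])
    rw [Real.dist_eq] at this
    exact this.le
  set S := Metric.closedBall (0 : Fin n → ℝ) (R : ℝ) with hS
  have hSm : MeasurableSet S := Metric.isClosed_closedBall.measurableSet
  have hT2 : ∀ᵐ x, latticeOp (Sᶜ.indicator κ) 1 x ≤ M := by
    filter_upwards [hT] with x hx
    exact (latticeOp_mono (Set.indicator_le_self _ _) (fun _ => le_rfl) x).trans hx
  filter_upwards [eventually_ge_atTop 1, eventually_gt_atTop ((R : ℝ) + 1),
    (tendsto_id.atTop_mul_const hη).eventually_gt_atTop ((R : ℝ) + 1)] with w hw1 hwR hwη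
  have hw0 : 0 < w := one_pos.trans_le hw1
  have hTw : ∀ᵐ x : Fin n → ℝ, latticeOp κ 1 (w • x) ≤ M :=
    (Measure.quasiMeasurePreserving_smul volume hw0.ne').ae hT
  calc _ ≤ mixedLNorm n P (fun x => ω * M * (Metric.closedBall 0 (L + 1)).indicator 1 x +
        latticeOp (Sᶜ.indicator κ) (fun t => ‖g (w⁻¹ • t) - g x‖ₑ) (w • x)) := by
        refine mixedLNorm_mono_ae hP0 ?_
        filter_upwards [hTw] with x hx
        have hinc : Measurable fun t => ‖g (w⁻¹ • t) - g x‖ₑ :=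
          ((hg.measurable.comp (measurable_const_smul _)).sub_const _).enorm
        rw [latticeOp_eq_add_compl hκ hinc hSm]
        refine add_le_add ((latticeOp_closedBall_sub_le hκ hL hgη' hw0 hwη hwR x).trans ?_) le_rfl
        rw [ENNReal.ofReal_coe_nnreal, ← mul_assoc, mul_comm _ (ω : ℝ≥0∞)]
        exact mul_le_mul_left (mul_le_mul_right hx _) _
    _ ≤ mixedLNorm n P (fun x => ω * M * (Metric.closedBall 0 (L + 1)).indicator 1 x) +
        mixedLNorm n P (fun x =>
          latticeOp (Sᶜ.indicator κ) (fun t => ‖g (w⁻¹ • t) - g x‖ₑ) (w • x)) := by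
        exact mixedLNorm_add_le hP (hBm.const_mul _)
          (measurable_latticeOp_sub (hκ.indicator hSm.compl) hg.measurable w)
    _ ≤ ε / 2 + ε / 2 := by
        refine add_le_add ?_ ((mixedLNorm_latticeOp_sub_le hp hP hPp hmono
          (hκ.indicator hSm.compl) hM hT2 hg.measurable hN hL hw1).trans hR)
        rw [mixedLNorm_const_mul hP0 (ENNReal.mul_ne_top ENNReal.coe_ne_top hM), mul_assoc]
        exact hω.le
    _ = ε := ENNReal.add_halves ε

theorem tendsto_mixedLNorm_latticeOp_sub {n : ℕ} {P : Fin n → ℝ} {p : ℝ} (hp : 1 ≤ p)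
    (hP : ∀ i, 1 ≤ P i) (hPp : ∀ i, P i ≤ p) (hmono : Monotone P) {κ : (Fin n → ℝ) → ℝ≥0∞}
    (hκ : Measurable κ) (hint : ∫⁻ x, κ x ≠ ∞) {M : ℝ≥0∞} (hM : M ≠ ∞)
    (hT : ∀ᵐ x, latticeOp κ 1 x ≤ M) {f : (Fin n → ℝ) → ℝ} (hf : Measurable f)
    (hfin : mixedNorm P f < ∞) :
    Tendsto (fun w : ℝ => mixedLNorm n P
      (fun x => latticeOp κ (fun t => ‖f (w⁻¹ • t) - f x‖ₑ) (w • x))) atTop (𝓝 0) := by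
  have hP0 : ∀ i, 0 < P i := fun i => one_pos.trans_le (hP i)
  have hp0 : 0 < p := one_pos.trans_le hp
  set C := M ^ (1 - 1 / p) * (∫⁻ x, κ x) ^ (1 / p) with hC
  have hCfin : C ≠ ∞ := ENNReal.mul_ne_top
    (ENNReal.rpow_ne_top_of_nonneg (sub_nonneg.2 ((div_le_one hp0).2 hp)) hM)
    (ENNReal.rpow_ne_top_of_nonneg (by positivity) hint)
  refine ENNReal.tendsto_nhds_zero.2 fun ε hε => ?_
  have hε2 : 0 < ε / 2 := ENNReal.half_pos hε.ne'
  obtain ⟨δ, hδ0, hδ⟩ := ENNReal.exists_nnreal_pos_mul_lt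
    (ENNReal.add_ne_top.2 ⟨hCfin, hM⟩) hε2.ne'
  obtain ⟨g, hg, hgs, hfg⟩ := exists_hasCompactSupport_mixedNorm_sub_le hP hf hfin
    (ENNReal.coe_ne_zero.2 hδ0.ne')
  have hd : Measurable fun x => ‖f x - g x‖ₑ := (hf.sub hg.measurable).enorm
  filter_upwards [eventually_gt_atTop 0, ENNReal.tendsto_nhds_zero.1
    (tendsto_mixedLNorm_latticeOp_sub_of_hasCompactSupport hp hP hPp hmono hκ hint hM hT hg hgs)
    _ hε2] with w hw0 hw
  have hTw : ∀ᵐ x : Fin n → ℝ, latticeOp κ 1 (w • x) ≤ M :=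
    (Measure.quasiMeasurePreserving_smul volume hw0.ne').ae hT
  have hdw : Measurable fun t => ‖f (w⁻¹ • t) - g (w⁻¹ • t)‖ₑ :=
    hd.comp (measurable_const_smul _)
  have hm1 : Measurable fun x => latticeOp κ (fun t => ‖f (w⁻¹ • t) - g (w⁻¹ • t)‖ₑ) (w • x) :=
    (measurable_latticeOp hκ hdw).comp (measurable_const_smul _)
  calc _ ≤ mixedLNorm n P (fun x =>
        (latticeOp κ (fun t => ‖f (w⁻¹ • t) - g (w⁻¹ • t)‖ₑ) (w • x) + M * ‖f x - g x‖ₑ) +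
          latticeOp κ (fun t => ‖g (w⁻¹ • t) - g x‖ₑ) (w • x)) := by
        refine mixedLNorm_mono_ae hP0 ?_
        filter_upwards [hTw] with x hx
        calc _ ≤ latticeOp κ (fun t => (‖f (w⁻¹ • t) - g (w⁻¹ • t)‖ₑ + ‖f x - g x‖ₑ) +
              ‖g (w⁻¹ • t) - g x‖ₑ) (w • x) := by
              refine latticeOp_mono (fun _ => le_rfl) (fun t => ?_) _
              rw [show f (w⁻¹ • t) - f x = (f (w⁻¹ • t) - g (w⁻¹ • t)) - (f x - g x) +
                (g (w⁻¹ • t) - g x) by ring]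
              exact (enorm_add_le _ _).trans (add_le_add enorm_sub_le le_rfl)
          _ = latticeOp κ (fun t => ‖f (w⁻¹ • t) - g (w⁻¹ • t)‖ₑ) (w • x) +
              latticeOp κ 1 (w • x) * ‖f x - g x‖ₑ +
                latticeOp κ (fun t => ‖g (w⁻¹ • t) - g x‖ₑ) (w • x) := by
              rw [latticeOp_add hκ (hdw.add_const _), latticeOp_add hκ hdw, latticeOp_const hκ]
          _ ≤ _ := add_le_add (add_le_add le_rfl (mul_le_mul_left hx _)) le_rfl
    _ ≤ (mixedLNorm n P (fun x =>
          latticeOp κ (fun t => ‖f (w⁻¹ • t) - g (w⁻¹ • t)‖ₑ) (w • x)) +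
        mixedLNorm n P (fun x => M * ‖f x - g x‖ₑ)) +
        mixedLNorm n P (fun x => latticeOp κ (fun t => ‖g (w⁻¹ • t) - g x‖ₑ) (w • x)) := by
        exact (mixedLNorm_add_le hP (hm1.add (hd.const_mul _))
          (measurable_latticeOp_sub hκ hg.measurable w)).trans
          (add_le_add (mixedLNorm_add_le hP hm1 (hd.const_mul _)) le_rfl)
    _ ≤ (C * δ + M * δ) + ε / 2 := by
        refine add_le_add (add_le_add ?_ ?_) hw
        · exact (mixedLNorm_latticeOp_dilate_le hp hP hPp hmono hκ hd hM hT hw0).trans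
            (mul_le_mul_right hfg _)
        · rw [mixedLNorm_const_mul hP0 hM]
          exact mul_le_mul_right hfg _
    _ ≤ ε / 2 + ε / 2 := by
        refine add_le_add ?_ le_rfl
        rw [← add_mul, mul_comm]
        exact hδ.le
    _ = ε := ENNReal.add_halves ε

end MixedKantorovich

theorem mainTheorem3 {n : ℕ} (hn : 0 < n)
    (χ : (Fin n → ℝ) → ℝ) (α : ℝ) (hα : 0 ≤ α) (hχ : MixedKantorovich.IsKernel α χ)
    (P : Fin n → ℝ) (hP : ∀ i, 1 ≤ P i) (hmono : Monotone P)
    (f : (Fin n → ℝ) → ℝ) (hf : MixedKantorovich.MemMixedLp P f) :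
    LocallyIntegrable f volume ∧
      (∀ w : ℝ, 0 < w →
        (∀ x, Summable (MixedKantorovich.kantorovichTerm χ w f x)) ∧
          MixedKantorovich.MemMixedLp P (MixedKantorovich.kantorovich χ w f)) ∧
      Tendsto
        (fun w : ℝ =>
          MixedKantorovich.mixedNorm P (fun x => MixedKantorovich.kantorovich χ w f x - f x))
        atTop (𝓝 0) := by
  open MixedKantorovich in
  have hP0 : ∀ i, 0 < P i := fun i => one_pos.trans_le (hP i)
  obtain ⟨p, hp, hPp⟩ : ∃ p : ℝ, 1 ≤ p ∧ ∀ i, P i ≤ p := by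
    refine ⟨P ⟨n - 1, by omega⟩, hP _, fun i => hmono ?_⟩
    rw [Fin.le_def]
    simp only
    omega
  have hp0 : 0 < p := one_pos.trans_le hp
  -- A measurable representative: neither the mixed norms nor the cell integrals see the change.
  obtain ⟨hfm, hfin⟩ := hf
  set f' := hfm.mk f with hf'
  have hae : f =ᵐ[volume] f' := hfm.ae_eq_mk
  have hm : Measurable f' := hfm.stronglyMeasurable_mk.measurable
  have hfin' : mixedNorm P f' < ∞ := by
    refine lt_of_eq_of_lt (mixedLNorm_congr_ae hP0 ?_) hfin
    filter_upwards [hae] with x hx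
    rw [hx]
  have hterm : ∀ w, kantorovichTerm χ w f = kantorovichTerm χ w f' := fun w => by
    ext x k
    rw [kantorovichTerm, kantorovichTerm, integral_congr_ae (ae_restrict_of_ae hae)]
  have hK : ∀ w, kantorovich χ w f = kantorovich χ w f' := fun w => by
    ext x
    rw [kantorovich, kantorovich, hterm]
  obtain ⟨M, hM, hχM⟩ := hχ.exists_latticeOp_enorm_le hα
  obtain ⟨κ, hκ, hint, hκχ⟩ := exists_measurable_enorm_subInt_eq hχ.integrable
  have hT : ∀ᵐ x, latticeOp κ 1 x ≤ M := by
    filter_upwards [hκχ] with x hx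
    rw [← latticeOp_congr_kernel (κ := fun u => ‖χ u‖ₑ) hx]
    exact hχM x
  have hbound : ∀ w : ℝ, 0 < w → ∀ᵐ x : Fin n → ℝ, ∀ c : ℝ, ‖kantorovich χ w f' x - c‖ₑ ≤
      latticeOp κ (fun t => ‖f' (w⁻¹ • t) - c‖ₑ) (w • x) := fun w hw => by
    obtain ⟨C, hC, hfC⟩ := exists_setLIntegral_cell_le hp hP hPp hmono hm hfin' hw
    filter_upwards [(Measure.quasiMeasurePreserving_smul volume hw.ne').ae hκχ] with x hx c
    rw [← latticeOp_congr_kernel (κ := fun u => ‖χ u‖ₑ) hx]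
    exact enorm_kantorovich_sub_le hw hm hC hfC (hχ.hasSum_one _) c
  refine ⟨?_, fun w hw => ?_, ?_⟩
  · exact (locallyIntegrable_of_mixedLNorm_lt_top hp hP hPp hmono hm hfin').congr hae.symm
  · obtain ⟨C, hC, hfC⟩ := exists_setLIntegral_cell_le hp hP hPp hmono hm hfin' hw
    have hsum : ∀ x, Summable (kantorovichTerm χ w f' x) := fun x =>
      summable_kantorovichTerm hw hC hfC (hχ.hasSum_one _).summable
    rw [hterm, hK]
    refine ⟨hsum, aestronglyMeasurable_kantorovich hχ.integrable.aestronglyMeasurable hw hsum, ?_⟩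
    calc mixedNorm P (kantorovich χ w f')
        ≤ mixedLNorm n P (fun x => latticeOp κ (fun t => ‖f' (w⁻¹ • t)‖ₑ) (w • x)) := by
          refine mixedLNorm_mono_ae hP0 ?_
          filter_upwards [hbound w hw] with x hx
          simpa using hx 0
      _ ≤ M ^ (1 - 1 / p) * (∫⁻ x, κ x) ^ (1 / p) * mixedNorm P f' :=
          mixedLNorm_latticeOp_dilate_le hp hP hPp hmono hκ hm.enorm hM hT hw
      _ < ∞ := ENNReal.mul_lt_top (ENNReal.mul_lt_top
          (ENNReal.rpow_lt_top_of_nonneg (sub_nonneg.2 ((div_le_one hp0).2 hp)) hM)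
          (ENNReal.rpow_lt_top_of_nonneg (by positivity) hint)) hfin'
  · refine tendsto_of_tendsto_of_tendsto_of_le_of_le' tendsto_const_nhds
      (tendsto_mixedLNorm_latticeOp_sub hp hP hPp hmono hκ hint hM hT hm hfin')
      (Eventually.of_forall fun _ => zero_le) ?_
    filter_upwards [eventually_gt_atTop 0] with w hw
    refine mixedLNorm_mono_ae hP0 ?_
    filter_upwards [hbound w hw, hae] with x hx hfx
    rw [hK, hfx]
    exact hx (f' x)
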